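/- Let $n\ge 0$ and let $A(-\infty),A(+\infty)\in\mathbb{R}^{n\times n}$ be symmetric invertible matrices. For a symmetric matrix $M$ let $\mathrm{ind}\,M$ denote its negative index of inertia, i.e. the maximal dimension of a subspace on which $x\mapsto x^{T}Mx$ is negative definite. A bounded operator is Fredholm if it has finite-dimensional kernel and closed range of finite codimension; its index is $\dim\ker-\dim\mathrm{coker}$. (a) Let $A:\mathbb{R}\to\mathbb{R}^{n\times n}$ be continuous with $\lim_{t\to\pm\infty}A(t)=A(\pm\infty)$. Then the bounded operator $$F_A:W^{1,2}(\mathbb{R},\mathbb{R}^n)\to L^2(\mathbb{R},\mathbb{R}^n),\qquad (F_A\xi)(t)=\dot\xi(t)+A(t)\xi(t),$$ is Fredholm with index $\mathrm{ind}\,A(-\infty)-\mathrm{ind}\,A(+\infty)$. (b) Let $\ell\ge 0$, and for every $\mathbf{s}\in[0,1]^{\ell}$ let $A(\mathbf{s},\cdot):\mathbb{R}\to\mathbb{R}^{n\times n}$ be continuous with $\lim_{t\to\pm\infty}A(\mathbf{s},t)=A(\pm\infty)$. Then for every $\mathbf{s}\in[0,1]^\ell$ and every linear map $K:\mathbb{R}^{\ell}\to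 L^2(\mathbb{R},\mathbb{R}^n)$ (the derivative in the directions of the parameters; $K=0$ is allowed) the bounded operator $$F_{[\ell]A}:\mathbb{R}^{\ell}\times W^{1,2}(\mathbb{R},\mathbb{R}^n)\to L^2(\mathbb{R},\mathbb{R}^n),\qquad F_{[\ell]A}(\sigma,\xi)(t)=\dot\xi(t)+A(\mathbf{s},t)\xi(t)+(K\sigma)(t),$$ is Fredholm with index $\mathrm{ind}\,A(-\infty)-\mathrm{ind}\,A(+\infty)+\ell$. -/

import Mathlib

open MeasureTheory Filter Topology
open scoped ContDiff ENNReal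

noncomputable section

namespace FredholmLine

/-- The Hilbert space `L²(ℝ, ℝⁿ)`, where `ℝⁿ` carries the Euclidean norm. -/
abbrev L2 (n : ℕ) : Type :=
  Lp (EuclideanSpace ℝ (Fin n)) 2 (volume : Measure ℝ)

/-- `g` is the weak derivative of `f` on `ℝ`: `∫ φ' f = - ∫ φ g` for all test functions
`φ ∈ C_c^∞(ℝ)`. -/
def IsWeakDeriv {n : ℕ} (f g : ℝ → EuclideanSpace ℝ (Fin n)) : Prop :=
  ∀ φ : ℝ → ℝ, ContDiff ℝ ∞ φ → HasCompactSupport φ →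
    ∫ t, deriv φ t • f t = - ∫ t, φ t • g t

theorem integrable_smul_L2 {n : ℕ} {φ : ℝ → ℝ} (hφ : Continuous φ) (hc : HasCompactSupport φ)
    (f : L2 n) : Integrable (fun t => φ t • f t) := by
  have h1 : MemLp φ 2 (volume : Measure ℝ) := hφ.memLp_of_hasCompactSupport hc
  have h2 := (Lp.memLp f).smul (r := 1) h1
  exact memLp_one_iff_integrable.1 h2

/-- The Sobolev space `W^{1,2}(ℝ, ℝⁿ)`, realised as the graph of the weak derivative: its elements
are the pairs `(ξ, ξ')` with `ξ ∈ L²` whose weak derivative `ξ'` is in `L²` (and is determined by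
`ξ`). The norm inherited from the Hilbert sum `L² ⊕ L²` is the usual Sobolev norm
`(‖ξ‖² + ‖ξ'‖²)^{1/2}`. -/
def W12 (n : ℕ) : Submodule ℝ (WithLp 2 (L2 n × L2 n)) where
  carrier := {p | IsWeakDeriv (p.fst : ℝ → EuclideanSpace ℝ (Fin n)) p.snd}
  zero_mem' := by
    intro φ _ _
    have h := Lp.coeFn_zero (EuclideanSpace ℝ (Fin n)) 2 (volume : Measure ℝ)
    have h1 : ∀ ψ : ℝ → ℝ, ∫ t, ψ t • (0 : L2 n) t = 0 := fun ψ => by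
      rw [integral_eq_zero_of_ae]
      filter_upwards [h] with t ht
      rw [ht]
      simp
    simp only [WithLp.zero_fst, WithLp.zero_snd]
    rw [h1, h1, neg_zero]
  add_mem' := by
    intro p q hp hq φ hφ hc
    have hd : Continuous (deriv φ) := hφ.continuous_deriv (by simp)
    have key : ∀ ψ : ℝ → ℝ, Continuous ψ → HasCompactSupport ψ → ∀ f g : L2 n,
        ∫ t, ψ t • (f + g : L2 n) t = (∫ t, ψ t • f t) + ∫ t, ψ t • g t := by
      intro ψ h1 h2 f g
      rw [← integral_add (integrable_smul_L2 h1 h2 f) (integrable_smul_L2 h1 h2 g)]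
      refine integral_congr_ae ?_
      filter_upwards [Lp.coeFn_add f g] with t ht
      rw [ht, Pi.add_apply, smul_add]
    simp only [WithLp.add_fst, WithLp.add_snd]
    rw [key _ hd hc.deriv, key _ hφ.continuous hc, hp φ hφ hc, hq φ hφ hc, neg_add]
  smul_mem' := by
    intro c p hp φ hφ hc
    have key : ∀ (ψ : ℝ → ℝ) (f : L2 n),
        ∫ t, ψ t • (c • f : L2 n) t = c • ∫ t, ψ t • f t := by
      intro ψ f
      rw [← integral_smul]
      refine integral_congr_ae ?_
      filter_upwards [Lp.coeFn_smul c f] with t ht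
      rw [ht, Pi.smul_apply, smul_comm]
    simp only [WithLp.smul_fst, WithLp.smul_snd]
    rw [key, key, hp φ hφ hc, smul_neg]

/-- The inclusion `W^{1,2} → L²`, `ξ ↦ ξ`. -/
def W12.incl (n : ℕ) : W12 n →L[ℝ] L2 n :=
  (WithLp.fstL 2 ℝ (L2 n) (L2 n)).comp (W12 n).subtypeL

/-- The weak derivative `∂ₜ : W^{1,2} → L²`, `ξ ↦ ξ'`. -/
def W12.dt (n : ℕ) : W12 n →L[ℝ] L2 n :=
  (WithLp.sndL 2 ℝ (L2 n) (L2 n)).comp (W12 n).subtypeL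

/-- The linear map of `ℝⁿ` given by a square matrix. -/
abbrev act {n : ℕ} (M : Matrix (Fin n) (Fin n) ℝ) :
    EuclideanSpace ℝ (Fin n) →L[ℝ] EuclideanSpace ℝ (Fin n) :=
  Matrix.toEuclideanCLM (𝕜 := ℝ) M

theorem continuous_act {n : ℕ} :
    Continuous (act : Matrix (Fin n) (Fin n) ℝ → _) :=
  LinearMap.continuous_of_finiteDimensional
    ((Matrix.toEuclideanCLM (n := Fin n) (𝕜 := ℝ)).toAlgEquiv.toLinearMap)

/-- A continuous path of matrices with limits at `±∞` is bounded. -/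
theorem exists_bound {n : ℕ} {A : ℝ → Matrix (Fin n) (Fin n) ℝ} (hA : Continuous A)
    {Am Ap : Matrix (Fin n) (Fin n) ℝ} (hm : Tendsto A atBot (𝓝 Am))
    (hp : Tendsto A atTop (𝓝 Ap)) : ∃ C, ∀ t, ‖act (A t)‖ ≤ C := by
  have hc : Continuous fun t => ‖act (A t)‖ := (continuous_act.comp hA).norm
  have h1 : Tendsto (fun t => ‖act (A t)‖) atBot (𝓝 ‖act Am‖) :=
    ((continuous_act.tendsto Am).comp hm).norm
  have h2 : Tendsto (fun t => ‖act (A t)‖) atTop (𝓝 ‖act Ap‖) :=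
    ((continuous_act.tendsto Ap).comp hp).norm
  obtain ⟨a, ha⟩ := eventually_atBot.1 (h1.eventually_le_const (lt_add_one _))
  obtain ⟨b, hb⟩ := eventually_atTop.1 (h2.eventually_le_const (lt_add_one _))
  obtain ⟨C, hC⟩ := (isCompact_Icc (a := a) (b := b)).bddAbove_image hc.continuousOn
  refine ⟨max (max (‖act Am‖ + 1) (‖act Ap‖ + 1)) C, fun t => ?_⟩
  rcases le_total t a with h | h
  · exact (ha t h).trans ((le_max_left _ _).trans (le_max_left _ _))
  rcases le_total b t with h' | h'
  · exact (hb t h').trans ((le_max_right _ _).trans (le_max_left _ _))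
  · exact (hC ⟨t, ⟨h, h'⟩, rfl⟩).trans (le_max_right _ _)

theorem memLp_act {n : ℕ} {A : ℝ → Matrix (Fin n) (Fin n) ℝ} (hA : Continuous A)
    (hb : ∃ C, ∀ t, ‖act (A t)‖ ≤ C) (f : L2 n) :
    MemLp (fun t => act (A t) (f t)) 2 (volume : Measure ℝ) := by
  obtain ⟨C, hC⟩ := hb
  refine (Lp.memLp f).of_le_mul (c := C) ?_ (ae_of_all _ fun t => ?_)
  · have h1 : AEStronglyMeasurable (fun t => act (A t)) (volume : Measure ℝ) :=
      (continuous_act.comp hA).aestronglyMeasurable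
    exact (isBoundedBilinearMap_apply (𝕜 := ℝ)).continuous.comp_aestronglyMeasurable
      (h1.prodMk (Lp.aestronglyMeasurable f))
  · exact ((act (A t)).le_opNorm _).trans (mul_le_mul_of_nonneg_right (hC t) (norm_nonneg _))

/-- The multiplication operator `f ↦ A(·) f(·)` on `L²(ℝ, ℝⁿ)`, for `A` continuous and bounded. -/
def mulOp {n : ℕ} (A : ℝ → Matrix (Fin n) (Fin n) ℝ) (hA : Continuous A)
    (hb : ∃ C, ∀ t, ‖act (A t)‖ ≤ C) : L2 n →L[ℝ] L2 n :=
  LinearMap.mkContinuousOfExistsBound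
    { toFun := fun f => (memLp_act hA hb f).toLp
      map_add' := fun f g => by
        rw [← MemLp.toLp_add, MemLp.toLp_eq_toLp_iff]
        filter_upwards [Lp.coeFn_add f g] with t ht
        simp only [ht, Pi.add_apply, map_add]
      map_smul' := fun c f => by
        rw [RingHom.id_apply, ← MemLp.toLp_const_smul, MemLp.toLp_eq_toLp_iff]
        filter_upwards [Lp.coeFn_smul c f] with t ht
        simp only [ht, Pi.smul_apply, map_smul] }
    (by
      obtain ⟨C, hC⟩ := hb
      refine ⟨C, fun f => Lp.norm_le_mul_norm_of_ae_le_mul ?_⟩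
      filter_upwards [(memLp_act hA ⟨C, hC⟩ f).coeFn_toLp] with t ht
      simp only [LinearMap.coe_mk, AddHom.coe_mk, ht]
      exact ((act (A t)).le_opNorm _).trans
        (mul_le_mul_of_nonneg_right (hC t) (norm_nonneg _)))

/-- The operator `F_A = ∂ₜ + A(t) : W^{1,2}(ℝ, ℝⁿ) → L²(ℝ, ℝⁿ)`, for `A` continuous and
bounded. -/
def opF {n : ℕ} (A : ℝ → Matrix (Fin n) (Fin n) ℝ) (hA : Continuous A)
    (hb : ∃ C, ∀ t, ‖act (A t)‖ ≤ C) : W12 n →L[ℝ] L2 n :=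
  W12.dt n + (mulOp A hA hb).comp (W12.incl n)

/-- The parametrized operator `(σ, ξ) ↦ ξ' + A(t) ξ + K σ` on `ℝ^ℓ × W^{1,2}(ℝ, ℝⁿ)`: the shape of
the linearization, in the `ℓ` parameters and the path together, of a parametrized gradient flow
equation. `K σ` is the derivative of the equation in the direction `σ` of the parameters. -/
def opFParam {n : ℕ} (l : ℕ) (A : ℝ → Matrix (Fin n) (Fin n) ℝ) (hA : Continuous A)
    (hb : ∃ C, ∀ t, ‖act (A t)‖ ≤ C) (K : EuclideanSpace ℝ (Fin l) →L[ℝ] L2 n) :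
    (EuclideanSpace ℝ (Fin l) × W12 n) →L[ℝ] L2 n :=
  K.coprod (opF A hA hb)

/-- The index `dim ker T - dim coker T` of a (Fredholm) operator. -/
def fredholmIndex {X Y : Type*} [NormedAddCommGroup X] [NormedSpace ℝ X]
    [NormedAddCommGroup Y] [NormedSpace ℝ Y] (T : X →L[ℝ] Y) : ℤ :=
  (Module.finrank ℝ T.ker : ℤ) - (Module.finrank ℝ (Y ⧸ T.range) : ℤ)

/-- The negative index of inertia of a symmetric real matrix: the maximal dimension of a subspace
on which the quadratic form `x ↦ xᵀ M x` is negative definite. -/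
def negInd {n : ℕ} (M : Matrix (Fin n) (Fin n) ℝ) : ℕ :=
  sigNeg (M.toQuadraticForm' : QuadraticForm ℝ (Fin n → ℝ))

end FredholmLine

end

/-!
Compare `F_A = ∂ₜ + A(t)` with the model operator whose coefficient jumps from `A(-∞)` to `A(+∞)` at
the origin. The difference is multiplication by a coefficient vanishing at infinity. A function in
`W^{1,2}` is Hölder continuous of exponent `1/2`, so on a bounded interval it is uniformly
approximated by step functions, and the difference is a norm limit of finite-rank operators
`W^{1,2} → L²`. Hence both operators are Fredholm with the same index as soon as the model is.

Let `N₋` and `N₊` be the spans of the negative eigenvectors of `A(-∞)` and `A(+∞)`. A solution of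
the homogeneous model equation is a linear flow on each half line. It is square integrable at `-∞`
exactly when its value at `0` lies in `N₋`, and at `+∞` exactly when that value lies in `N₊ᗮ`. So
the kernel of the model is `N₋ ⊓ N₊ᗮ`. Its cokernel is the kernel of the adjoint, which is, up to
sign, the model for `-A`, namely `N₋ᗮ ⊓ N₊`. The index is therefore `dim N₋ - dim N₊`.

Every parameter adds one to the index: restricting `(σ, ξ) ↦ K σ + T ξ` to `σ = 0` gives `T`, and
the inclusion of the second factor has index `-ℓ`.
-/

open scoped NNReal

noncomputable section

namespace FredholmLine

/-! ### Stability of the Fredholm property and of the index -/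

section QuasiInverse

open LinearMap LinearMap.FiniteRangeSetoid

variable {K V W : Type*} [Field K] [AddCommGroup V] [Module K V] [AddCommGroup W] [Module K W]

theorem finiteDimensional_ker_of_isLeftQuasiInverse {u : V →ₗ[K] W} {v : W →ₗ[K] V}
    (h : v.IsLeftQuasiInverse u) : FiniteDimensional K u.ker := by
  have hrange : FiniteDimensional K (LinearMap.id - v ∘ₗ u).range :=
    .of_fg (hasFiniteRange_iff_range.1 (equiv_iff_hasFiniteRange.1 (Setoid.symm h.equiv)))
  have hker : u.ker ≤ (LinearMap.id - v ∘ₗ u).range := by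
    intro x hx
    have hx : u x = 0 := hx
    exact ⟨x, by simp [hx]⟩
  exact Submodule.finiteDimensional_of_le hker

theorem finiteDimensional_coker_of_isRightQuasiInverse {u : V →ₗ[K] W} {v : W →ₗ[K] V}
    (h : v.IsRightQuasiInverse u) : FiniteDimensional K (W ⧸ u.range) :=
  (equiv_iff_eqLocus_coFG.1 h.equiv).of_le fun y (hy : u (v y) = y) => ⟨v y, hy⟩

theorem index_comp_of_isQuasiInverse {Z : Type*} [AddCommGroup Z] [Module K Z]
    {u : V →ₗ[K] W} {u' : W →ₗ[K] V} {w : W →ₗ[K] Z} {w' : Z →ₗ[K] W}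
    (hw : w'.IsQuasiInverse w) (hu : u'.IsQuasiInverse u) :
    (w ∘ₗ u).index = w.index + u.index := by
  have := finiteDimensional_ker_of_isLeftQuasiInverse hu.1
  have := finiteDimensional_coker_of_isRightQuasiInverse hu.2
  have := finiteDimensional_ker_of_isLeftQuasiInverse hw.1
  have := finiteDimensional_coker_of_isRightQuasiInverse hw.2
  exact index_comp w

theorem index_eq_zero_of_equiv_id {u : V →ₗ[K] V} (h : u ≈ LinearMap.id) : u.index = 0 := by
  set S := eqLocus u LinearMap.id
  have : S.CoFG := equiv_iff_eqLocus_coFG.1 h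
  have hcomp : u ∘ₗ S.subtype = S.subtype := LinearMap.ext fun x => x.2
  have : FiniteDimensional K u.ker :=
    finiteDimensional_ker_of_isLeftQuasiInverse (v := LinearMap.id) h
  have : FiniteDimensional K (V ⧸ u.range) :=
    finiteDimensional_coker_of_isRightQuasiInverse (v := LinearMap.id) h
  have : FiniteDimensional K S.subtype.ker := by rw [S.ker_subtype]; infer_instance
  have : FiniteDimensional K (V ⧸ S.subtype.range) := by rw [S.range_subtype]; infer_instance
  have hindex := index_comp (f := S.subtype) u
  rw [hcomp] at hindex
  lia

theorem index_eq_neg_of_isQuasiInverse {u : V →ₗ[K] W} {v : W →ₗ[K] V}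
    (h : v.IsQuasiInverse u) : u.index = -v.index := by
  have hcomp := index_comp_of_isQuasiInverse h.symm h
  rw [index_eq_zero_of_equiv_id h.1.equiv] at hcomp
  lia

theorem isQuasiInverse_snd_inr [FiniteDimensional K W] :
    (LinearMap.snd K W V).IsQuasiInverse (LinearMap.inr K W V) := by
  refine ⟨by simp [IsLeftQuasiInverse, snd_comp_inr], equiv_iff_hasNoetherianRange.2 ?_⟩
  have hsub : LinearMap.inr K W V ∘ₗ LinearMap.snd K W V - LinearMap.id =
      -LinearMap.inl K W V ∘ₗ LinearMap.fst K W V := by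
    ext <;> simp
  rw [hsub]
  have hfst : (LinearMap.fst K W V).HasNoetherianRange := .of_isNoetherian_rng
  exact (hfst.comp_left _).neg

theorem index_inr : (LinearMap.inr K W V).index = -Module.finrank K W := by
  have hquot := ((Submodule.quotEquivOfEq _ _ (LinearMap.range_inr K W V)).trans
    ((LinearMap.fst K W V).quotKerEquivOfSurjective fst_surjective)).finrank_eq
  rw [index_of_injective inr_injective, hquot]

end QuasiInverse

section Fredholm

open LinearMap LinearMap.FiniteRangeSetoid ContinuousLinearMap

variable {𝕜 X Y : Type*} [NontriviallyNormedField 𝕜]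
  [NormedAddCommGroup X] [NormedSpace 𝕜 X] [NormedAddCommGroup Y] [NormedSpace 𝕜 Y]

theorem exists_isQuasiInverse_add_of_norm_comp_lt_one [CompleteSpace X] {T P : X →L[𝕜] Y}
    {v : Y →L[𝕜] X} (hv : v.IsQuasiInverse T.toLinearMap) (hP : ‖v ∘L P‖ < 1) :
    ∃ U : X ≃L[𝕜] X, (U.symm.toLinearEquiv.toLinearMap ∘ₗ v.toLinearMap).IsQuasiInverse
      (T + P).toLinearMap := by
  let U := ContinuousLinearEquiv.ofUnit (Units.oneSub (-(v ∘L P)) (by rwa [norm_neg]))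
  have hcomp : v.toLinearMap ∘ₗ (T + P).toLinearMap ≈ U.toLinearEquiv.toLinearMap := by
    have hU : U.toLinearEquiv.toLinearMap = .id + v.toLinearMap ∘ₗ P.toLinearMap := by
      ext x
      change (1 - -(v ∘L P)) x = _
      simp
    rw [hU, toLinearMap_add, LinearMap.comp_add]
    exact equiv_iff_hasNoetherianRange.2 (by
      simpa using equiv_iff_hasNoetherianRange.1 hv.1.equiv)
  exact ⟨U, .of_comp_right hv.symm (U.toLinearEquiv.isQuasiInverse.congr (Setoid.refl _) hcomp)⟩

theorem comp_mem_closure_hasFiniteRange {Z : Type*} [NormedAddCommGroup Z] [NormedSpace 𝕜 Z]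
    (S : Y →L[𝕜] Z) {K : X →L[𝕜] Y}
    (hK : K ∈ closure {R : X →L[𝕜] Y | R.toLinearMap.HasFiniteRange}) :
    S ∘L K ∈ closure {R : X →L[𝕜] Z | R.toLinearMap.HasFiniteRange} :=
  map_mem_closure (continuous_const.clm_comp continuous_id) hK fun _ hR => hR.comp_left _

variable [CompleteSpace 𝕜]

/-- If `v` is a quasi-inverse of `T` and `R` is a finite-rank map close to `K`, then a quasi-inverse
of `T + (K - R)`, hence of `T + K`, is `v` followed by an automorphism, so all indices are
`-index v`. -/
theorem isFredholm_add_and_index_add_eq [CompleteSpace X] {T K : X →L[𝕜] Y}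
    (hT : T.IsFredholm) (hK : K ∈ closure {R : X →L[𝕜] Y | R.toLinearMap.HasFiniteRange}) :
    (T + K).IsFredholm ∧ (T + K).toLinearMap.index = T.toLinearMap.index := by
  obtain ⟨v, hv⟩ := hT.exists_isQuasiInverse
  obtain ⟨R, hR, hKR⟩ := Metric.mem_closure_iff.1 hK (‖v‖ + 1)⁻¹ (by positivity)
  have hsmall : ‖v ∘L (K - R)‖ < 1 := calc
    ‖v ∘L (K - R)‖ ≤ ‖v‖ * ‖K - R‖ := v.opNorm_comp_le _
    _ ≤ ‖v‖ * (‖v‖ + 1)⁻¹ := by gcongr; exact (dist_eq_norm K R ▸ hKR).le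
    _ < 1 := by rw [← div_eq_mul_inv, div_lt_one (by positivity)]; exact lt_add_one _
  obtain ⟨U, hU⟩ := exists_isQuasiInverse_add_of_norm_comp_lt_one hv hsmall
  have hequiv : (T + K).toLinearMap ≈ (T + (K - R)).toLinearMap := by
    rw [equiv_iff_hasFiniteRange, ← toLinearMap_sub]
    simpa using hR
  have hTK := hU.congr (Setoid.refl _) hequiv
  refine ⟨.of_isQuasiInverse (v := U.symm.toContinuousLinearMap ∘L v) hTK, ?_⟩
  rw [index_eq_neg_of_isQuasiInverse hTK, index_eq_neg_of_isQuasiInverse hv,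
    index_comp_of_isQuasiInverse U.symm.toLinearEquiv.isQuasiInverse hv.symm,
    LinearEquiv.index_eq_zero, zero_add]

theorem isFredholm_coprod_and_index_coprod {Z : Type*} [NormedAddCommGroup Z] [NormedSpace 𝕜 Z]
    [FiniteDimensional 𝕜 Z] {T : X →L[𝕜] Y} (hT : T.IsFredholm) (K : Z →L[𝕜] Y) :
    (K.coprod T).IsFredholm ∧
      (K.coprod T).toLinearMap.index = T.toLinearMap.index + Module.finrank 𝕜 Z := by
  obtain ⟨v, hv⟩ := hT.exists_isQuasiInverse
  have hcomp : (K.coprod T).toLinearMap ∘ₗ LinearMap.inr 𝕜 Z X = T.toLinearMap := by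
    ext x
    simp
  have hq : (LinearMap.inr 𝕜 Z X ∘ₗ v.toLinearMap).IsQuasiInverse (K.coprod T).toLinearMap :=
    .of_comp_left isQuasiInverse_snd_inr (hcomp ▸ hv)
  refine ⟨.of_isQuasiInverse (v := .inr 𝕜 Z X ∘L v) hq, ?_⟩
  have hindex := index_comp_of_isQuasiInverse hq isQuasiInverse_snd_inr
  rw [hcomp, index_inr] at hindex
  lia

end Fredholm

section Banach

open ContinuousLinearMap

variable {X Y : Type*} [NormedAddCommGroup X] [NormedSpace ℝ X] [CompleteSpace X]
  [NormedAddCommGroup Y] [NormedSpace ℝ Y] [CompleteSpace Y]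

theorem isClosed_range_of_finiteDimensional_coker (T : X →L[ℝ] Y)
    [FiniteDimensional ℝ (Y ⧸ T.range)] : IsClosed (T.range : Set Y) := by
  obtain ⟨C, hC⟩ := T.range.exists_isCompl
  have : FiniteDimensional ℝ C := .of_fg (Submodule.CoFG.fg_of_isCompl hC inferInstance)
  let S : X × C →L[ℝ] Y := T.coprod C.subtypeL
  have hS : Function.Surjective S := by
    intro y
    obtain ⟨_, ⟨x, rfl⟩, c, hc, hy⟩ :=
      Submodule.mem_sup.1 (hC.sup_eq_top ▸ Submodule.mem_top : y ∈ T.range ⊔ C)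
    exact ⟨(x, ⟨c, hc⟩), hy⟩
  have hpre : S ⁻¹' T.range = {p | p.2 = 0} := by
    ext ⟨x, c⟩
    have hc : (c : Y) ∈ T.range ↔ c = 0 :=
      ⟨fun h => Subtype.ext ((Submodule.disjoint_def.1 hC.disjoint) c h c.2),
        fun h => h ▸ T.range.zero_mem⟩
    exact (T.range.add_mem_iff_right ⟨x, rfl⟩).trans hc
  rw [← (S.isQuotientMap hS).isClosed_preimage, hpre]
  exact isClosed_eq continuous_snd continuous_const

theorem isFredholm_of_finiteDimensional (T : X →L[ℝ] Y)
    [FiniteDimensional ℝ T.ker] [FiniteDimensional ℝ (Y ⧸ T.range)] : T.IsFredholm := by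
  have hclosed := isClosed_range_of_finiteDimensional_coker T
  have : CompleteSpace T.range := hclosed.completeSpace_coe
  let T' : X →L[ℝ] T.range := T.codRestrict T.range fun x => ⟨x, rfl⟩
  have hT' : Function.Surjective T' := fun y => y.2.imp fun x hx => Subtype.ext hx
  refine ⟨?_, hclosed, inferInstance, ‹_›, .of_finiteDimensional _⟩
  exact (T.range.isEmbedding_subtype.isStrictMap_iff (f := T')).1
    (T'.isQuotientMap hT').isStrictMap

end Banach

theorem fredholmIndex_eq_index {X Y : Type*} [NormedAddCommGroup X] [NormedSpace ℝ X]
    [NormedAddCommGroup Y] [NormedSpace ℝ Y] (T : X →L[ℝ] Y) :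
    fredholmIndex T = T.toLinearMap.index :=
  LinearMap.index_eq_finrank_sub.symm

/-! ### Primitives and weak derivatives -/

section Primitive

variable {V : Type*} [NormedAddCommGroup V]

theorem intervalIntegrable_of_locallyIntegrable {f : ℝ → V} (hf : LocallyIntegrable f) (a b : ℝ) :
    IntervalIntegrable f volume a b :=
  intervalIntegrable_iff.2 <|
    (hf.integrableOn_isCompact isCompact_uIcc).mono_set Set.uIoc_subset_uIcc

variable [NormedSpace ℝ V]

/-- `F` is a primitive of the locally integrable function `f`, in the sense of Lebesgue: `F` is
locally absolutely continuous and `F' = f` almost everywhere. -/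
structure IsPrimitive (F f : ℝ → V) : Prop where
  locallyIntegrable : LocallyIntegrable f
  integral_eq_sub : ∀ a b, ∫ t in a..b, f t = F b - F a

theorem isPrimitive_add_integral {f : ℝ → V} (hf : LocallyIntegrable f) (c : V) :
    IsPrimitive (fun t => c + ∫ s in (0 : ℝ)..t, f s) f where
  locallyIntegrable := hf
  integral_eq_sub a b := by
    have hint := intervalIntegrable_of_locallyIntegrable hf
    rw [add_sub_add_left_eq_sub,
      intervalIntegral.integral_interval_sub_left (hint _ _) (hint _ _)]

theorem isPrimitive_deriv [CompleteSpace V] {F : ℝ → V} (hF : ContDiff ℝ 1 F) :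
    IsPrimitive F (deriv F) where
  locallyIntegrable := (hF.continuous_deriv le_rfl).locallyIntegrable
  integral_eq_sub a b := intervalIntegral.integral_deriv_eq_sub
    (fun _ _ => (hF.differentiable one_ne_zero).differentiableAt)
    ((hF.continuous_deriv le_rfl).intervalIntegrable a b)

namespace IsPrimitive

variable {F f : ℝ → V}

theorem eq_add_integral (h : IsPrimitive F f) (a : ℝ) :
    F = fun t => F a + ∫ s in a..t, f s := by
  ext t
  rw [h.integral_eq_sub, add_sub_cancel]

theorem continuous (h : IsPrimitive F f) : Continuous F := by
  rw [h.eq_add_integral 0]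
  exact continuous_const.add <| intervalIntegral.continuous_primitive
    (intervalIntegrable_of_locallyIntegrable h.locallyIntegrable) 0

theorem ae_hasDerivAt [CompleteSpace V] (h : IsPrimitive F f) : ∀ᵐ t, HasDerivAt F (f t) t := by
  filter_upwards [_root_.LocallyIntegrable.ae_hasDerivAt_integral h.locallyIntegrable] with t ht
  rw [h.eq_add_integral 0]
  exact (ht 0).const_add _

theorem clm_comp {W : Type*} [NormedAddCommGroup W] [NormedSpace ℝ W] [CompleteSpace V]
    [CompleteSpace W] (h : IsPrimitive F f) (L : V →L[ℝ] W) :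
    IsPrimitive (fun t => L (F t)) (fun t => L (f t)) where
  locallyIntegrable x := (h.locallyIntegrable x).imp fun _ hs => ⟨hs.1, L.integrable_comp hs.2⟩
  integral_eq_sub a b := by
    rw [L.intervalIntegral_comp_comm (intervalIntegrable_of_locallyIntegrable
      h.locallyIntegrable a b), h.integral_eq_sub, map_sub]

theorem sum {ι : Type*} (s : Finset ι) {F f : ι → ℝ → V} (h : ∀ i, IsPrimitive (F i) (f i)) :
    IsPrimitive (fun t => ∑ i ∈ s, F i t) (fun t => ∑ i ∈ s, f i t) where
  locallyIntegrable := locallyIntegrable_finsetSum s fun i _ => (h i).locallyIntegrable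
  integral_eq_sub a b := by
    simp only [intervalIntegral.integral_finsetSum fun i _ =>
      intervalIntegrable_of_locallyIntegrable (h i).locallyIntegrable a b,
      (h _).integral_eq_sub, Finset.sum_sub_distrib]

theorem absolutelyContinuousOnInterval {F f : ℝ → ℝ} (h : IsPrimitive F f) (a b : ℝ) :
    AbsolutelyContinuousOnInterval F a b := by
  have hconst : AbsolutelyContinuousOnInterval (fun _ : ℝ => F a) a b :=
    contDiffOn_const.absolutelyContinuousOnInterval
  rw [h.eq_add_integral a]
  exact hconst.add <| (intervalIntegrable_of_locallyIntegrable h.locallyIntegrable a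
    b).absolutelyContinuousOnInterval_intervalIntegral Set.left_mem_uIcc

theorem mul {F f G g : ℝ → ℝ} (hF : IsPrimitive F f) (hG : IsPrimitive G g) :
    IsPrimitive (fun t => F t * G t) (fun t => f t * G t + F t * g t) where
  locallyIntegrable := by
    refine .add ?_ ?_
    · rw [← locallyIntegrableOn_univ]
      exact (hF.locallyIntegrable.locallyIntegrableOn _).mul_continuousOn
        hG.continuous.continuousOn isOpen_univ.isLocallyClosed
    · rw [← locallyIntegrableOn_univ]
      exact (hG.locallyIntegrable.locallyIntegrableOn _).continuousOn_mul
        hF.continuous.continuousOn isOpen_univ.isLocallyClosed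
  integral_eq_sub a b := by
    rw [← (hF.absolutelyContinuousOnInterval a b).integral_deriv_mul_eq_sub
      (hG.absolutelyContinuousOnInterval a b)]
    refine intervalIntegral.integral_congr_ae ?_
    filter_upwards [hF.ae_hasDerivAt, hG.ae_hasDerivAt] with t hFt hGt _
    rw [hFt.deriv, hGt.deriv]

theorem real_inner {E : Type*} [NormedAddCommGroup E] [InnerProductSpace ℝ E]
    [FiniteDimensional ℝ E] {F f G g : ℝ → E} (hF : IsPrimitive F f) (hG : IsPrimitive G g) :
    IsPrimitive (fun t => inner ℝ (F t) (G t))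
      (fun t => inner ℝ (f t) (G t) + inner ℝ (F t) (g t)) := by
  let b := stdOrthonormalBasis ℝ E
  have hcoord (x y : E) : inner ℝ x y = ∑ i, innerSL ℝ (b i) x * innerSL ℝ (b i) y := by
    simp only [innerSL_apply_apply, ← b.sum_inner_mul_inner x y, real_inner_comm x]
  simp only [hcoord, ← Finset.sum_add_distrib]
  exact .sum _ fun i => (hF.clm_comp (innerSL ℝ (b i))).mul (hG.clm_comp (innerSL ℝ (b i)))

theorem integral_eq_zero (h : IsPrimitive F f) (hF : Integrable F) (hf : Integrable f) :
    ∫ t, f t = 0 := by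
  have hlim : Tendsto (fun R : ℝ => F R - F (-R)) atTop (𝓝 (∫ t, f t)) := by
    simpa only [h.integral_eq_sub, id] using
      intervalIntegral_tendsto_integral hf tendsto_neg_atTop_atBot tendsto_id
  refine IntegrableAtFilter.eq_zero_of_tendsto (μ := volume)
    ((hF.sub hF.comp_neg).integrableAtFilter atTop) (fun s hs => ?_) hlim
  obtain ⟨a, ha⟩ := mem_atTop_sets.1 hs
  exact measure_mono_top (fun t ht => ha t ht) (Real.volume_Ici (a := a))

end IsPrimitive

end Primitive

section WeakDeriv

variable {n : ℕ}

theorem IsPrimitive.isWeakDeriv {F f : ℝ → EuclideanSpace ℝ (Fin n)} (h : IsPrimitive F f) :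
    IsWeakDeriv F f := by
  intro φ hφ hc
  have hderiv : Continuous (deriv φ) := hφ.continuous_deriv (by simp)
  have hF : Integrable fun t => deriv φ t • F t :=
    (hderiv.smul h.continuous).integrable_of_hasCompactSupport hc.deriv.smul_right
  have hf : Integrable fun t => φ t • f t :=
    h.locallyIntegrable.integrable_smul_left_of_hasCompactSupport hφ.continuous hc
  rw [eq_neg_iff_add_eq_zero, ← integral_add hF hf]
  refine ext_inner_left ℝ fun e => ?_
  have hφF : IsPrimitive (fun t => φ t * inner ℝ e (F t))
      (fun t => inner ℝ e (deriv φ t • F t + φ t • f t)) := by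
    simpa only [inner_add_right, inner_smul_right, innerSL_apply_apply] using
      (isPrimitive_deriv (hφ.of_le (by simp))).mul (h.clm_comp (innerSL ℝ e))
  have hsum : Integrable fun t => deriv φ t • F t + φ t • f t := hF.add hf
  rw [inner_zero_right, ← integral_inner hsum]
  exact hφF.integral_eq_zero
    ((hφ.continuous.mul (continuous_const.inner h.continuous)).integrable_of_hasCompactSupport
      hc.mul_right) (hsum.const_inner e)

variable {V : Type*} [NormedAddCommGroup V] [NormedSpace ℝ V] [CompleteSpace V]

theorem exists_contDiff_hasCompactSupport_deriv_eq {θ : ℝ → V} (hθ : ContDiff ℝ ∞ θ)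
    (hc : HasCompactSupport θ) (h0 : ∫ t, θ t = 0) :
    ∃ Θ : ℝ → V, ContDiff ℝ ∞ Θ ∧ HasCompactSupport Θ ∧ deriv Θ = θ := by
  obtain ⟨R, -, hR⟩ := hc.isCompact.isBounded.subset_ball_lt 0 0
  rw [Real.ball_eq_Ioo, zero_sub, zero_add] at hR
  have hout : ∀ t ∉ Set.Ioo (-R) R, θ t = 0 := fun t ht =>
    image_eq_zero_of_notMem_tsupport fun h => ht (hR h)
  let Θ : ℝ → V := fun t => ∫ s in (-R)..t, θ s
  have hΘ : ∀ t, HasDerivAt Θ (θ t) t := fun t =>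
    intervalIntegral.integral_hasDerivAt_right (hθ.continuous.intervalIntegrable _ _)
      (hθ.continuous.stronglyMeasurableAtFilter _ _) hθ.continuous.continuousAt
  have hderiv : deriv Θ = θ := funext fun t => (hΘ t).deriv
  refine ⟨Θ, ?_, .intro (isCompact_Icc (a := -R) (b := R)) fun t ht => ?_, hderiv⟩
  · rw [contDiff_infty_iff_deriv, hderiv]
    exact ⟨fun t => (hΘ t).differentiableAt, hθ⟩
  · rcases not_and_or.1 ht with ht | ht <;> rw [not_le] at ht
    · refine intervalIntegral.integral_zero_ae (ae_of_all _ fun s hs => hout s fun hs' => ?_)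
      rw [Set.uIoc_of_ge ht.le] at hs
      exact hs'.1.not_ge hs.2
    · refine (intervalIntegral.integral_eq_integral_of_support_subset fun s hs => ?_).trans h0
      have hs := not_imp_comm.1 (hout s) hs
      exact ⟨hs.1, (hs.2.trans ht).le⟩

/-- A test function `φ` differs from `(∫ φ) ψ`, with `ψ` a fixed bump function of integral one, by
the derivative of a test function. -/
theorem ae_eq_const_of_forall_integral_deriv_smul_eq_zero {h : ℝ → V} (hh : LocallyIntegrable h)
    (h0 : ∀ φ : ℝ → ℝ, ContDiff ℝ ∞ φ → HasCompactSupport φ → ∫ t, deriv φ t • h t = 0) :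
    ∃ c, ∀ᵐ t, h t = c := by
  let b : ContDiffBump (0 : ℝ) := ⟨1, 2, one_pos, one_lt_two⟩
  let ψ : ℝ → ℝ := b.normed volume
  have hψ : ContDiff ℝ ∞ ψ := b.contDiff_normed
  have hψc : HasCompactSupport ψ := b.hasCompactSupport_normed
  have hψh := hh.integrable_smul_left_of_hasCompactSupport hψ.continuous hψc
  refine ⟨∫ t, ψ t • h t, ?_⟩
  refine ae_eq_of_integral_contDiff_smul_eq hh continuous_const.locallyIntegrable
    fun φ hφ hφc => ?_
  have hφh := hh.integrable_smul_left_of_hasCompactSupport hφ.continuous hφc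
  have hmean : ∫ t, (φ t - (∫ s, φ s) * ψ t) = 0 := by
    rw [integral_sub (hφ.continuous.integrable_of_hasCompactSupport hφc)
      ((hψ.continuous.integrable_of_hasCompactSupport hψc).const_mul _), integral_const_mul,
      b.integral_normed, mul_one, sub_self]
  obtain ⟨Θ, hΘ, hΘc, hderiv⟩ := exists_contDiff_hasCompactSupport_deriv_eq
    (hφ.sub (contDiff_const.mul hψ)) (hφc.sub hψc.mul_left) hmean
  have hzero := h0 Θ hΘ hΘc
  simp only [hderiv, sub_smul, mul_smul] at hzero
  rwa [integral_sub hφh (hψh.fun_smul _), integral_smul, sub_eq_zero,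
    ← integral_smul_const] at hzero

end WeakDeriv

/-! ### The Sobolev space -/

theorem norm_setIntegral_le_sqrt_mul_norm {α E : Type*} [MeasurableSpace α] {μ : Measure α}
    [NormedAddCommGroup E] [NormedSpace ℝ E] (f : Lp E 2 μ) {s : Set α} (hs : μ s ≠ ⊤) :
    ‖∫ x in s, f x ∂μ‖ ≤ √(μ.real s) * ‖f‖ := by
  have hle : ‖∫ x in s, f x ∂μ‖ₑ ≤ eLpNorm f 2 μ * μ s ^ (1 / 2 : ℝ) :=
    calc ‖∫ x in s, f x ∂μ‖ₑ ≤ ∫⁻ x in s, ‖f x‖ₑ ∂μ := enorm_integral_le_lintegral_enorm _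
      _ = eLpNorm f 1 (μ.restrict s) := eLpNorm_one_eq_lintegral_enorm.symm
      _ ≤ eLpNorm f 2 (μ.restrict s) * μ s ^ (1 / 2 : ℝ) := by
        convert! eLpNorm_le_eLpNorm_mul_rpow_measure_univ one_le_two
          (Lp.aestronglyMeasurable f).restrict using 2
        norm_num
      _ ≤ eLpNorm f 2 μ * μ s ^ (1 / 2 : ℝ) := by
        gcongr
        exact Measure.restrict_le_self
  rw [← toReal_enorm, Lp.norm_def, mul_comm, Real.sqrt_eq_rpow, Measure.real,
    ENNReal.toReal_rpow, ← ENNReal.toReal_mul]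
  exact ENNReal.toReal_mono
    (ENNReal.mul_ne_top (Lp.eLpNorm_ne_top f) (ENNReal.rpow_ne_top_of_nonneg (by norm_num) hs)) hle

theorem locallyIntegrable_Lp_two {E : Type*} [NormedAddCommGroup E]
    (f : Lp E 2 (volume : Measure ℝ)) : LocallyIntegrable f :=
  (Lp.memLp f).locallyIntegrable one_le_two

variable {n : ℕ}

theorem IsWeakDeriv.congr_ae {f g f' g' : ℝ → EuclideanSpace ℝ (Fin n)} (h : IsWeakDeriv f g)
    (hf : f =ᵐ[volume] f') (hg : g =ᵐ[volume] g') : IsWeakDeriv f' g' := by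
  intro φ hφ hc
  have smul_congr (ψ : ℝ → ℝ) {u v : ℝ → EuclideanSpace ℝ (Fin n)} (huv : u =ᵐ[volume] v) :
      ∫ t, ψ t • u t = ∫ t, ψ t • v t := integral_congr_ae (huv.mono fun t ht => by simp only [ht])
  rw [← smul_congr _ hf, ← smul_congr _ hg, h φ hφ hc]

namespace W12

theorem isWeakDeriv (p : W12 n) : IsWeakDeriv (incl n p) (dt n p) := p.2

theorem norm_sq (p : W12 n) : ‖p‖ ^ 2 = ‖incl n p‖ ^ 2 + ‖dt n p‖ ^ 2 :=
  WithLp.prod_norm_sq_eq_of_L2 (p : WithLp 2 (L2 n × L2 n))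

theorem norm_incl_le (p : W12 n) : ‖incl n p‖ ≤ ‖p‖ :=
  le_of_sq_le_sq (by rw [norm_sq]; exact le_add_of_nonneg_right (sq_nonneg _)) (norm_nonneg _)

theorem norm_dt_le (p : W12 n) : ‖dt n p‖ ≤ ‖p‖ :=
  le_of_sq_le_sq (by rw [norm_sq]; exact le_add_of_nonneg_left (sq_nonneg _)) (norm_nonneg _)

theorem exists_isPrimitive (p : W12 n) :
    ∃ F, IsPrimitive F (dt n p) ∧ incl n p =ᵐ[volume] F := by
  have hp := locallyIntegrable_Lp_two (incl n p)
  have hG := isPrimitive_add_integral (locallyIntegrable_Lp_two (dt n p)) 0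
  obtain ⟨c, hc⟩ := ae_eq_const_of_forall_integral_deriv_smul_eq_zero
    (hp.sub hG.continuous.locallyIntegrable) fun φ hφ hφc => by
      have hφ' : Continuous (deriv φ) := hφ.continuous_deriv (by simp)
      simp only [Pi.sub_apply, smul_sub]
      rw [integral_sub (hp.integrable_smul_left_of_hasCompactSupport hφ' hφc.deriv)
        (hG.continuous.locallyIntegrable.integrable_smul_left_of_hasCompactSupport hφ' hφc.deriv),
        (isWeakDeriv p) φ hφ hφc, hG.isWeakDeriv φ hφ hφc, sub_self]
  refine ⟨_, isPrimitive_add_integral (locallyIntegrable_Lp_two (dt n p)) c, ?_⟩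
  filter_upwards [hc] with t ht
  rw [← ht, Pi.sub_apply, zero_add, sub_add_cancel]

/-- The continuous representative of an element of `W^{1,2}`. -/
def rep (p : W12 n) : ℝ → EuclideanSpace ℝ (Fin n) := (exists_isPrimitive p).choose

theorem isPrimitive_rep (p : W12 n) : IsPrimitive (rep p) (dt n p) :=
  (exists_isPrimitive p).choose_spec.1

theorem incl_ae_eq_rep (p : W12 n) : incl n p =ᵐ[volume] rep p :=
  (exists_isPrimitive p).choose_spec.2

theorem memLp_rep (p : W12 n) : MemLp (rep p) 2 :=
  (memLp_congr_ae (incl_ae_eq_rep p)).1 (Lp.memLp _)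

theorem rep_eq {p : W12 n} {F : ℝ → EuclideanSpace ℝ (Fin n)} (hF : Continuous F)
    (h : incl n p =ᵐ[volume] F) : rep p = F :=
  ((isPrimitive_rep p).continuous.ae_eq_iff_eq volume hF).1 ((incl_ae_eq_rep p).symm.trans h)

theorem rep_add (p q : W12 n) : rep (p + q) = rep p + rep q := by
  refine rep_eq ((isPrimitive_rep p).continuous.add (isPrimitive_rep q).continuous) ?_
  rw [map_add]
  exact (Lp.coeFn_add _ _).trans ((incl_ae_eq_rep p).add (incl_ae_eq_rep q))

theorem rep_smul (c : ℝ) (p : W12 n) : rep (c • p) = c • rep p := by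
  refine rep_eq ((isPrimitive_rep p).continuous.const_smul c) ?_
  rw [map_smul]
  exact (Lp.coeFn_smul _ _).trans ((incl_ae_eq_rep p).const_smul c)

theorem exists_rep_eq_and_dt_ae_eq {F f : ℝ → EuclideanSpace ℝ (Fin n)} (h : IsPrimitive F f)
    (hF : MemLp F 2) (hf : MemLp f 2) : ∃ p : W12 n, rep p = F ∧ dt n p =ᵐ[volume] f := by
  have hw : IsWeakDeriv (hF.toLp F) (hf.toLp f) :=
    h.isWeakDeriv.congr_ae hF.coeFn_toLp.symm hf.coeFn_toLp.symm
  let p : W12 n := ⟨.toLp 2 (hF.toLp F, hf.toLp f), hw⟩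
  exact ⟨p, rep_eq (p := p) h.continuous hF.coeFn_toLp, hf.coeFn_toLp⟩

theorem incl_injective : Function.Injective (incl n) := by
  intro p q h
  have hrep : rep p = rep q :=
    rep_eq (isPrimitive_rep q).continuous (by rw [h]; exact incl_ae_eq_rep q)
  refine Subtype.ext (WithLp.ofLp_injective 2 (Prod.ext h (Lp.ext ?_)))
  filter_upwards [(isPrimitive_rep p).ae_hasDerivAt, (isPrimitive_rep q).ae_hasDerivAt] with t hp hq
  exact (hrep ▸ hp).unique hq

theorem norm_rep_sub_rep_le (p : W12 n) {s t : ℝ} (hst : s ≤ t) :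
    ‖rep p t - rep p s‖ ≤ √(t - s) * ‖p‖ := by
  rw [← (isPrimitive_rep p).integral_eq_sub, intervalIntegral.integral_of_le hst]
  refine (norm_setIntegral_le_sqrt_mul_norm (dt n p) (by simp)).trans ?_
  rw [Real.volume_real_Ioc_of_le hst]
  gcongr
  exact norm_dt_le p

theorem norm_rep_le (p : W12 n) (t : ℝ) : ‖rep p t‖ ≤ 2 * ‖p‖ := by
  have hvol : volume.real (Set.Ioc t (t + 1)) = 1 := by
    rw [Real.volume_real_Ioc_of_le (by linarith), add_sub_cancel_left]
  have hmean : ‖∫ s in t..t + 1, rep p s‖ ≤ ‖p‖ := by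
    rw [intervalIntegral.integral_of_le (by linarith),
      ← integral_congr_ae (ae_restrict_of_ae (incl_ae_eq_rep p))]
    refine (norm_setIntegral_le_sqrt_mul_norm (incl n p) (by simp)).trans ?_
    rw [hvol, Real.sqrt_one, one_mul]
    exact norm_incl_le p
  have hosc : ‖∫ s in t..t + 1, (rep p s - rep p t)‖ ≤ ‖p‖ := by
    refine (intervalIntegral.norm_integral_le_of_norm_le_const (C := ‖p‖) fun s hs => ?_).trans
      (by simp)
    rw [Set.uIoc_of_le (by linarith)] at hs
    have hsqrt : √(s - t) ≤ 1 := Real.sqrt_le_one.2 (by linarith [hs.2])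
    exact (norm_rep_sub_rep_le p hs.1.le).trans (mul_le_of_le_one_left (norm_nonneg p) hsqrt)
  have hsub : rep p t = (∫ s in t..t + 1, rep p s) - ∫ s in t..t + 1, (rep p s - rep p t) := by
    rw [intervalIntegral.integral_sub ((isPrimitive_rep p).continuous.intervalIntegrable _ _)
      intervalIntegrable_const, intervalIntegral.integral_const]
    simp
  rw [hsub]
  linarith [norm_sub_le (∫ s in t..t + 1, rep p s) (∫ s in t..t + 1, (rep p s - rep p t))]

/-- Evaluation of the continuous representative at a point, as a bounded operator. -/
def evalAt (t : ℝ) : W12 n →L[ℝ] EuclideanSpace ℝ (Fin n) :=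
  LinearMap.mkContinuous
    { toFun := fun p => rep p t
      map_add' := fun p q => by rw [rep_add, Pi.add_apply]
      map_smul' := fun c p => by rw [rep_smul, Pi.smul_apply, RingHom.id_apply] }
    2 fun p => norm_rep_le p t

theorem inner_dt_add_inner_dt (p q : W12 n) :
    inner ℝ (dt n p) (incl n q) + inner ℝ (incl n p) (dt n q) = 0 := by
  have hprod := (isPrimitive_rep p).real_inner (isPrimitive_rep q)
  have hinner : (fun t => inner ℝ (incl n p t) (incl n q t)) =ᵐ[volume]
      fun t => inner ℝ (rep p t) (rep q t) := by
    filter_upwards [incl_ae_eq_rep p, incl_ae_eq_rep q] with t hp hq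
    rw [hp, hq]
  have hderiv : (fun t => inner ℝ (dt n p t) (incl n q t) + inner ℝ (incl n p t) (dt n q t))
      =ᵐ[volume] fun t => inner ℝ (dt n p t) (rep q t) + inner ℝ (rep p t) (dt n q t) := by
    filter_upwards [incl_ae_eq_rep p, incl_ae_eq_rep q] with t hp hq
    rw [hp, hq]
  have hint := L2.integrable_inner (𝕜 := ℝ) (incl n p) (incl n q)
  have hint₁ := L2.integrable_inner (𝕜 := ℝ) (dt n p) (incl n q)
  have hint₂ := L2.integrable_inner (𝕜 := ℝ) (incl n p) (dt n q)
  rw [L2.inner_def, L2.inner_def, ← integral_add hint₁ hint₂, integral_congr_ae hderiv]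
  exact hprod.integral_eq_zero (hint.congr hinner) ((hint₁.add hint₂).congr hderiv)

end W12

theorem isWeakDeriv_iff_forall_inner {f g : L2 n} :
    IsWeakDeriv f g ↔
      ∀ p : W12 n, inner ℝ (W12.dt n p) f + inner ℝ (W12.incl n p) g = 0 := by
  refine ⟨fun h p => W12.inner_dt_add_inner_dt p ⟨.toLp 2 (f, g), h⟩, fun h φ hφ hc => ?_⟩
  have hφ' : Continuous (deriv φ) := hφ.continuous_deriv (by simp)
  have hf := integrable_smul_L2 hφ' hc.deriv f
  have hg := integrable_smul_L2 hφ.continuous hc g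
  rw [eq_neg_iff_add_eq_zero]
  refine ext_inner_left ℝ fun e => ?_
  obtain ⟨p, hp, hp'⟩ := W12.exists_rep_eq_and_dt_ae_eq
    ((isPrimitive_deriv (hφ.of_le (by simp))).clm_comp (.toSpanSingleton ℝ e))
    ((hφ.continuous.smul continuous_const).memLp_of_hasCompactSupport hc.smul_right)
    ((hφ'.smul continuous_const).memLp_of_hasCompactSupport hc.deriv.smul_right)
  rw [inner_zero_right, inner_add_right, ← integral_inner hf, ← integral_inner hg, ← h p,
    L2.inner_def, L2.inner_def]
  congr 1 <;> refine integral_congr_ae ?_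
  · filter_upwards [hp'] with t ht
    rw [ht, ContinuousLinearMap.toSpanSingleton_apply, real_inner_smul_left,
      real_inner_smul_right]
  · filter_upwards [W12.incl_ae_eq_rep p] with t ht
    simp only [ht, hp, ContinuousLinearMap.toSpanSingleton_apply, real_inner_smul_left,
      real_inner_smul_right]

instance W12.completeSpace : CompleteSpace (W12 n) := by
  have heq : (W12 n : Set (WithLp 2 (L2 n × L2 n))) =
      ⋂ p : W12 n, {x | inner ℝ (W12.dt n p) x.fst + inner ℝ (W12.incl n p) x.snd = 0} := by
    ext x
    rw [Set.mem_iInter]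
    exact isWeakDeriv_iff_forall_inner
  have hclosed : IsClosed (W12 n : Set (WithLp 2 (L2 n × L2 n))) := by
    rw [heq]
    refine isClosed_iInter fun p => isClosed_eq ?_ continuous_const
    exact (continuous_const.inner (WithLp.fstL 2 ℝ (L2 n) (L2 n)).continuous).add
      (continuous_const.inner (WithLp.sndL 2 ℝ (L2 n) (L2 n)).continuous)
  exact hclosed.completeSpace_coe

/-! ### Zeroth order perturbations of the derivative -/

section MultOp

variable {α E : Type*} [MeasurableSpace α] {μ : Measure α} [NormedAddCommGroup E]

/-- Multiplication `f ↦ B(·) f(·)` by an essentially bounded coefficient `B`, as a bounded operator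
on `L²` that depends linearly and continuously on `B`. -/
def multOp [NormedSpace ℝ E] : Lp (E →L[ℝ] E) ∞ μ →L[ℝ] Lp E 2 μ →L[ℝ] Lp E 2 μ :=
  (ContinuousLinearMap.id ℝ (E →L[ℝ] E)).holderL μ ∞ 2 2

theorem multOp_ae_eq [NormedSpace ℝ E] (B : Lp (E →L[ℝ] E) ∞ μ) (f : Lp E 2 μ) :
    multOp B f =ᵐ[μ] fun t => B t (f t) :=
  (ContinuousLinearMap.id ℝ (E →L[ℝ] E)).coeFn_holder B f

theorem isSymmetric_multOp [InnerProductSpace ℝ E] {B : Lp (E →L[ℝ] E) ∞ μ}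
    (hB : ∀ᵐ t ∂μ, (B t).IsSymmetric) : (multOp B).IsSymmetric := by
  intro f g
  simp only [ContinuousLinearMap.coe_coe, L2.inner_def]
  refine integral_congr_ae ?_
  filter_upwards [multOp_ae_eq B f, multOp_ae_eq B g, hB] with t hf hg ht
  rw [hf, hg]
  exact ht _ _

theorem isSymmetric_compLpL [InnerProductSpace ℝ E] {S : E →L[ℝ] E} (hS : S.IsSymmetric) :
    (S.compLpL 2 μ).IsSymmetric := by
  intro f g
  simp only [ContinuousLinearMap.coe_coe, L2.inner_def]
  refine integral_congr_ae ?_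
  filter_upwards [S.coeFn_compLpL f, S.coeFn_compLpL g] with t hf hg
  rw [hf, hg]
  exact hS _ _

end MultOp

variable {n : ℕ}

/-- The operator `∂ₜ + T : W^{1,2} → L²`, for a bounded operator `T` on `L²`. -/
def lineOp (T : L2 n →L[ℝ] L2 n) : W12 n →L[ℝ] L2 n :=
  W12.dt n + T.comp (W12.incl n)

theorem lineOp_apply (T : L2 n →L[ℝ] L2 n) (p : W12 n) :
    lineOp T p = W12.dt n p + T (W12.incl n p) := rfl

theorem lineOp_add (T T' : L2 n →L[ℝ] L2 n) :
    lineOp (T + T') = lineOp T + T'.comp (W12.incl n) := by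
  rw [lineOp, lineOp, ContinuousLinearMap.add_comp, add_assoc]

theorem orthogonal_range_lineOp {T : L2 n →L[ℝ] L2 n} (hT : T.IsSymmetric) :
    (lineOp T).rangeᗮ = (lineOp (-T)).ker.map (W12.incl n).toLinearMap := by
  have hadj (p : W12 n) (g : L2 n) : inner ℝ (lineOp T p) g =
      inner ℝ (W12.dt n p) g + inner ℝ (W12.incl n p) (T g) := by
    rw [lineOp_apply, inner_add_left]
    exact congrArg _ (hT _ _)
  have hker (q : W12 n) : q ∈ (lineOp (-T)).ker ↔ W12.dt n q = T (W12.incl n q) := by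
    rw [LinearMap.mem_ker]
    exact add_neg_eq_zero
  ext g
  constructor
  · intro h
    have hg : IsWeakDeriv g (T g) := isWeakDeriv_iff_forall_inner.2 fun p => by
      rw [← hadj]
      exact h _ ⟨p, rfl⟩
    exact ⟨⟨.toLp 2 (g, T g), hg⟩, (hker _).2 rfl, rfl⟩
  · rintro ⟨q, hq, rfl⟩ _ ⟨p, rfl⟩
    exact (hadj p _).trans ((hker q).1 hq ▸ W12.inner_dt_add_inner_dt p q)

theorem finrank_coker_lineOp {T : L2 n →L[ℝ] L2 n} (hT : T.IsSymmetric)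
    (hclosed : IsClosed ((lineOp T).range : Set (L2 n))) :
    Module.finrank ℝ (L2 n ⧸ (lineOp T).range) = Module.finrank ℝ (lineOp (-T)).ker := by
  have : CompleteSpace (lineOp T).range := hclosed.completeSpace_coe
  rw [(Submodule.quotientEquivOfIsCompl _ _ (Submodule.isCompl_orthogonal _)).finrank_eq,
    orthogonal_range_lineOp hT]
  exact (Submodule.equivMapOfInjective _ W12.incl_injective _).finrank_eq.symm

section ConstantCoefficient

variable {S : EuclideanSpace ℝ (Fin n) →L[ℝ] EuclideanSpace ℝ (Fin n)}

theorem norm_sq_lineOp_compLpL (hS : S.IsSymmetric) (p : W12 n) :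
    ‖lineOp (S.compLpL 2 volume) p‖ ^ 2 = ‖W12.dt n p‖ ^ 2 + ‖S.compLp (W12.incl n p)‖ ^ 2 := by
  obtain ⟨q, hq, hq'⟩ := W12.exists_rep_eq_and_dt_ae_eq ((W12.isPrimitive_rep p).clm_comp S)
    (S.comp_memLp' (W12.memLp_rep p)) (S.comp_memLp' (Lp.memLp (W12.dt n p)))
  have hincl : W12.incl n q = S.compLp (W12.incl n p) := by
    refine Lp.ext ?_
    filter_upwards [W12.incl_ae_eq_rep q, W12.incl_ae_eq_rep p, S.coeFn_compLp (W12.incl n p)]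
      with t h₁ h₂ h₃
    rw [h₁, h₃, h₂, hq]
  have hdt : W12.dt n q = S.compLp (W12.dt n p) :=
    Lp.ext (hq'.trans (EventuallyEq.symm (S.coeFn_compLp (W12.dt n p))))
  have hparts := W12.inner_dt_add_inner_dt p q
  have hsymm : inner ℝ (S.compLp (W12.incl n p)) (W12.dt n p) =
      inner ℝ (W12.incl n p) (S.compLp (W12.dt n p)) :=
    isSymmetric_compLpL hS (W12.incl n p) (W12.dt n p)
  rw [hincl, hdt, ← hsymm, real_inner_comm, ← two_mul] at hparts
  change ‖W12.dt n p + S.compLp (W12.incl n p)‖ ^ 2 = _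
  rw [norm_add_sq_real, real_inner_comm, hparts, add_zero]

theorem antilipschitzWith_lineOp_compLpL (hS : S.IsSymmetric) {K : ℝ≥0}
    (hK : AntilipschitzWith K S) :
    AntilipschitzWith (max 1 K) (lineOp (S.compLpL 2 volume)) := by
  refine ContinuousLinearMap.antilipschitz_of_bound _ fun p => ?_
  have hincl : ‖W12.incl n p‖ ≤ K * ‖S.compLp (W12.incl n p)‖ := by
    refine Lp.norm_le_mul_norm_of_ae_le_mul ?_
    filter_upwards [S.coeFn_compLp (W12.incl n p)] with t ht
    rw [ht]
    exact S.bound_of_antilipschitz hK _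
  refine le_of_sq_le_sq ?_ (by positivity)
  calc ‖p‖ ^ 2 = ‖W12.dt n p‖ ^ 2 + ‖W12.incl n p‖ ^ 2 := by rw [W12.norm_sq, add_comm]
    _ ≤ (1 * ‖W12.dt n p‖) ^ 2 + (K * ‖S.compLp (W12.incl n p)‖) ^ 2 := by
      rw [one_mul]
      gcongr
    _ ≤ (max 1 K * ‖W12.dt n p‖) ^ 2 + (max 1 K * ‖S.compLp (W12.incl n p)‖) ^ 2 := by
      gcongr
      exacts [le_max_left _ _, le_max_right _ _]
    _ = (max 1 K * ‖lineOp (S.compLpL 2 volume) p‖) ^ 2 := by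
      rw [mul_pow _ ‖lineOp _ p‖, norm_sq_lineOp_compLpL hS]
      ring

theorem bijective_lineOp_compLpL (hS : S.IsSymmetric) (hinj : Function.Injective S) :
    Function.Bijective (lineOp (S.compLpL 2 volume)) := by
  obtain ⟨K, -, hK⟩ := S.toLinearMap.exists_antilipschitzWith (LinearMap.ker_eq_bot.2 hinj)
  have hneg : -(S.compLpL 2 volume) = (-S).compLpL 2 (volume : Measure ℝ) := by
    rw [← neg_one_smul ℝ S, ContinuousLinearMap.smul_compLpL, neg_one_smul]
  have hanti := antilipschitzWith_lineOp_compLpL hS hK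
  have hanti_neg : AntilipschitzWith (max 1 K) (lineOp (-(S.compLpL 2 volume))) := by
    rw [hneg]
    refine antilipschitzWith_lineOp_compLpL (fun x y => by simpa using hS x y) ?_
    simpa [AntilipschitzWith] using hK
  refine (ContinuousLinearMap.bijective_iff_dense_range_and_antilipschitz _).2 ⟨?_, _, hanti⟩
  rw [Submodule.topologicalClosure_eq_top_iff, orthogonal_range_lineOp (isSymmetric_compLpL hS),
    LinearMap.ker_eq_bot.2 hanti_neg.injective, Submodule.map_bot]

end ConstantCoefficient

/-! ### Diagonal operators -/

section Diagonal

variable {ι E : Type*} [Fintype ι] [NormedAddCommGroup E] [InnerProductSpace ℝ E]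
  {S : E →L[ℝ] E} {b : OrthonormalBasis ι ℝ E} {w : ι → ℝ}

/-- The vectors of the orthonormal basis `b` are eigenvectors of `S`, with the eigenvalues `w`. -/
def IsDiagonal (S : E →L[ℝ] E) (b : OrthonormalBasis ι ℝ E) (w : ι → ℝ) : Prop :=
  ∀ k, S (b k) = w k • b k

theorem IsDiagonal.neg (h : IsDiagonal S b w) : IsDiagonal (-S) b (-w) := fun k => by
  rw [neg_apply, h k, Pi.neg_apply, neg_smul]

theorem IsDiagonal.inner_apply (h : IsDiagonal S b w) (k : ι) (x : E) :
    inner ℝ (b k) (S x) = w k * inner ℝ (b k) x := by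
  have hx : S x = ∑ k, (w k * inner ℝ (b k) x) • b k := by
    conv_lhs => rw [← b.sum_repr' x]
    simp only [map_sum, map_smul, h _, smul_smul, mul_comm]
  rw [hx, b.orthonormal.inner_right_fintype]

theorem IsDiagonal.isSymmetric (h : IsDiagonal S b w) : S.IsSymmetric := fun x y => by
  rw [ContinuousLinearMap.coe_coe, ← b.sum_inner_mul_inner, ← b.sum_inner_mul_inner x]
  refine Finset.sum_congr rfl fun k _ => ?_
  rw [h.inner_apply, real_inner_comm, h.inner_apply, real_inner_comm]
  ring

theorem eq_of_forall_inner_eq {x y : E} (h : ∀ k, inner ℝ (b k) x = inner ℝ (b k) y) : x = y := by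
  rw [← b.sum_repr' x, ← b.sum_repr' y]
  simp only [h]

theorem IsDiagonal.injective (h : IsDiagonal S b w) (hw : ∀ k, w k ≠ 0) :
    Function.Injective S := fun x y hxy =>
  eq_of_forall_inner_eq fun k => mul_left_cancel₀ (hw k) <| by
    rw [← h.inner_apply, ← h.inner_apply, hxy]

/-- The span of the vectors of the orthonormal basis `b` that belong to negative eigenvalues. -/
def negSpace (b : OrthonormalBasis ι ℝ E) (w : ι → ℝ) : Submodule ℝ E :=
  Submodule.span ℝ (b '' {k | w k < 0})

theorem mem_negSpace {x : E} : x ∈ negSpace b w ↔ ∀ k, 0 ≤ w k → inner ℝ (b k) x = 0 := by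
  rw [negSpace, ← b.coe_toBasis, b.toBasis.mem_span_image]
  simp only [Set.subset_def, Finset.mem_coe, Finsupp.mem_support_iff, b.coe_toBasis_repr_apply,
    b.repr_apply_apply, Set.mem_ofPred_eq]
  exact forall_congr' fun k => by rw [← not_lt, not_imp_comm, b.coe_toBasis]

theorem mem_orthogonal_negSpace {x : E} :
    x ∈ (negSpace b w)ᗮ ↔ ∀ k, w k < 0 → inner ℝ (b k) x = 0 := by
  calc x ∈ (negSpace b w)ᗮ ↔ negSpace b w ≤ (ℝ ∙ x)ᗮ :=
        forall₂_congr fun _ _ => Submodule.mem_orthogonal_singleton_iff_inner_left.symm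
    _ ↔ ∀ k, w k < 0 → inner ℝ (b k) x = 0 := by
        rw [negSpace, Submodule.span_le, Set.image_subset_iff]
        exact forall_congr' fun k => imp_congr_right fun _ =>
          Submodule.mem_orthogonal_singleton_iff_inner_left

theorem negSpace_neg (hw : ∀ k, w k ≠ 0) : negSpace b (-w) = (negSpace b w)ᗮ := by
  ext x
  rw [mem_negSpace, mem_orthogonal_negSpace]
  refine forall_congr' fun k => ?_
  rw [Pi.neg_apply, Left.nonneg_neg_iff, (hw k).le_iff_lt]

theorem finrank_negSpace : Module.finrank ℝ (negSpace b w) = {k | w k < 0}.ncard := by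
  classical
  rw [negSpace, Set.image_eq_range]
  exact (finrank_span_eq_card (b.orthonormal.linearIndependent.comp _ Subtype.val_injective)).trans
    (Set.fintypeCard_eq_ncard _)

theorem finrank_inf_orthogonal_sub_finrank_orthogonal_inf [FiniteDimensional ℝ E]
    (U V : Submodule ℝ E) :
    (Module.finrank ℝ (U ⊓ Vᗮ : Submodule ℝ E) : ℤ) -
      Module.finrank ℝ (Uᗮ ⊓ V : Submodule ℝ E) = Module.finrank ℝ U - Module.finrank ℝ V := by
  have hsup := Submodule.finrank_sup_add_finrank_inf_eq U Vᗮ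
  have hcompl := Submodule.finrank_add_finrank_orthogonal (U ⊔ Vᗮ)
  have hV := Submodule.finrank_add_finrank_orthogonal V
  rw [← Submodule.inf_orthogonal, Submodule.orthogonal_orthogonal] at hcompl
  omega

end Diagonal

section Matrix

variable {n : ℕ} {M : Matrix (Fin n) (Fin n) ℝ}

theorem toQuadraticForm'_apply_eq_inner (x : Fin n → ℝ) :
    M.toQuadraticForm' x = inner ℝ (WithLp.toLp 2 x) (act M (WithLp.toLp 2 x)) := by
  rw [Matrix.toQuadraticForm', LinearMap.BilinMap.toQuadraticMap_apply,
    Matrix.toLinearMap₂'_apply', EuclideanSpace.inner_eq_star_dotProduct, dotProduct_comm]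
  rfl

theorem IsDiagonal.negInd_eq_ncard {b : OrthonormalBasis (Fin n) ℝ (EuclideanSpace ℝ (Fin n))}
    {w : Fin n → ℝ} (h : IsDiagonal (act M) b w) : negInd M = {k | w k < 0}.ncard := by
  let e : (Fin n → ℝ) ≃ₗ[ℝ] (Fin n → ℝ) := (WithLp.linearEquiv 2 ℝ (Fin n → ℝ)).symm ≪≫ₗ
    b.repr.toLinearEquiv ≪≫ₗ WithLp.linearEquiv 2 ℝ (Fin n → ℝ)
  have he (x : Fin n → ℝ) (k : Fin n) : e x k = inner ℝ (b k) (WithLp.toLp 2 x) :=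
    b.repr_apply_apply _ _
  refine QuadraticForm.sigNeg_of_equiv_weightedSumSquares ⟨⟨e, fun x => ?_⟩⟩
  rw [toQuadraticForm'_apply_eq_inner, ← b.sum_inner_mul_inner]
  change QuadraticMap.weightedSumSquares ℝ w (e x) = _
  rw [QuadraticMap.weightedSumSquares_apply]
  refine Finset.sum_congr rfl fun k _ => ?_
  rw [he, h.inner_apply, real_inner_comm, smul_eq_mul]
  ring

theorem exists_isDiagonal_act (hM : M.IsSymm) (hM' : IsUnit M) :
    ∃ (b : OrthonormalBasis (Fin n) ℝ (EuclideanSpace ℝ (Fin n))) (w : Fin n → ℝ),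
      IsDiagonal (act M) b w ∧ ∀ k, w k ≠ 0 := by
  have hH : M.IsHermitian := (Matrix.conjTranspose_eq_transpose_of_trivial M).trans hM
  have hdet : ∏ k, hH.eigenvalues k ≠ 0 := by
    have := ((Matrix.isUnit_iff_isUnit_det M).1 hM').ne_zero
    rwa [hH.det_eq_prod_eigenvalues] at this
  exact ⟨hH.eigenvectorBasis, hH.eigenvalues,
    fun k => WithLp.ofLp_injective 2 (hH.mulVec_eigenvectorBasis k),
    fun k => Finset.prod_ne_zero_iff.1 hdet k (Finset.mem_univ k)⟩

end Matrix

/-! ### The linear flow of a diagonal operator -/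

theorem IsPrimitive.piecewise_Iio {V : Type*} [NormedAddCommGroup V] [NormedSpace ℝ V]
    {F f G g : ℝ → V} {c : ℝ} (hF : IsPrimitive F f) (hG : IsPrimitive G g) (hc : F c = G c) :
    IsPrimitive ((Set.Iio c).piecewise F G) ((Set.Iio c).piecewise f g) := by
  have hloc : LocallyIntegrable ((Set.Iio c).piecewise f g) := by
    rw [← Set.indicator_add_compl_eq_piecewise]
    exact (hF.locallyIntegrable.indicator measurableSet_Iio).add
      (hG.locallyIntegrable.indicator measurableSet_Iio.compl)
  have hint := intervalIntegrable_of_locallyIntegrable hloc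
  have hfrom (t : ℝ) : ∫ s in c..t, (Set.Iio c).piecewise f g s =
      (Set.Iio c).piecewise F G t - G c := by
    rcases lt_or_ge t c with ht | ht
    · rw [Set.piecewise_eq_of_mem (Set.Iio c) F G ht, ← hc, ← hF.integral_eq_sub]
      refine intervalIntegral.integral_congr_ae ?_
      filter_upwards [compl_mem_ae_iff.2 (measure_singleton c)] with s hs hs'
      rw [Set.uIoc_of_ge ht.le] at hs'
      exact Set.piecewise_eq_of_mem (Set.Iio c) f g (hs'.2.lt_of_ne hs)
    · rw [Set.piecewise_eq_of_notMem (Set.Iio c) F G ht.not_gt, ← hG.integral_eq_sub]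
      refine intervalIntegral.integral_congr_ae (ae_of_all _ fun s hs => ?_)
      rw [Set.uIoc_of_le ht] at hs
      exact Set.piecewise_eq_of_notMem (Set.Iio c) f g hs.1.le.not_gt
  refine ⟨hloc, fun a b => ?_⟩
  rw [← intervalIntegral.integral_interval_sub_left (hint c b) (hint c a), hfrom, hfrom,
    sub_sub_sub_cancel_right]

theorem isPrimitive_exp_mul (a : ℝ) :
    IsPrimitive (fun t => Real.exp (a * t)) (fun t => a * Real.exp (a * t)) := by
  have hderiv : deriv (fun t => Real.exp (a * t)) = fun t => a * Real.exp (a * t) := by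
    ext t
    simpa [mul_comm] using (((hasDerivAt_id t).const_mul a).exp).deriv
  exact hderiv ▸ isPrimitive_deriv (by fun_prop)

theorem IsPrimitive.eq_exp {y f : ℝ → ℝ} (h : IsPrimitive y f) {a t : ℝ}
    (hf : ∀ᵐ s, s ∈ Set.uIoc 0 t → f s = -(a * y s)) : y t = Real.exp (-(a * t)) * y 0 := by
  have hconst : y t * Real.exp (a * t) = y 0 := by
    have hint := (h.mul (isPrimitive_exp_mul a)).integral_eq_sub 0 t
    rw [intervalIntegral.integral_zero_ae] at hint
    · simpa using (sub_eq_zero.1 hint.symm)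
    · filter_upwards [hf] with s hs hs'
      rw [hs hs']
      ring
  rw [Real.exp_neg, ← hconst]
  field_simp

theorem not_memLp_of_forall_le_norm {α E : Type*} [MeasurableSpace α] {μ : Measure α}
    [NormedAddCommGroup E] {f : α → E} {p : ℝ≥0∞} (hp : p ≠ 0) (hp' : p ≠ ⊤)
    (hμ : μ Set.univ = ⊤) {c : ℝ} (hc : 0 < c) (h : ∀ᵐ x ∂μ, c ≤ ‖f x‖) : ¬MemLp f p μ := by
  intro hf
  have hconst : MemLp (fun _ => c) p μ := hf.of_le aestronglyMeasurable_const <| by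
    simpa only [Real.norm_of_nonneg hc.le] using h
  simp [memLp_const_iff hp hp', hc.ne', hμ] at hconst

theorem memLp_two_exp_iff {a : ℝ} {μ : Measure ℝ} :
    MemLp (fun t => Real.exp (-(a * t))) 2 μ ↔
      Integrable (fun t => Real.exp (-(2 * a) * t)) μ := by
  rw [memLp_two_iff_integrable_sq (by fun_prop)]
  refine integrable_congr (ae_of_all _ fun t => ?_)
  beta_reduce
  rw [← Real.exp_nat_mul]
  congr 1
  push_cast
  ring

theorem memLp_two_exp_Iio_iff {a : ℝ} :
    MemLp (fun t => Real.exp (-(a * t))) 2 (volume.restrict (Set.Iio 0)) ↔ a < 0 := by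
  constructor
  · contrapose!
    refine fun ha => not_memLp_of_forall_le_norm two_ne_zero ENNReal.ofNat_ne_top (by simp) one_pos
      ((ae_restrict_iff' measurableSet_Iio).2 (ae_of_all _ fun t (ht : t < 0) => ?_))
    rw [Real.norm_of_nonneg (Real.exp_pos _).le, Real.one_le_exp_iff]
    nlinarith
  · refine fun ha => memLp_two_exp_iff.2 ?_
    exact (integrableOn_exp_mul_Iic (by linarith) 0).mono_set Set.Iio_subset_Iic_self

theorem memLp_two_exp_Ici_iff {a : ℝ} :
    MemLp (fun t => Real.exp (-(a * t))) 2 (volume.restrict (Set.Ici 0)) ↔ 0 < a := by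
  constructor
  · contrapose!
    refine fun ha => not_memLp_of_forall_le_norm two_ne_zero ENNReal.ofNat_ne_top (by simp) one_pos
      ((ae_restrict_iff' measurableSet_Ici).2 (ae_of_all _ fun t (ht : 0 ≤ t) => ?_))
    rw [Real.norm_of_nonneg (Real.exp_pos _).le, Real.one_le_exp_iff]
    nlinarith
  · refine fun ha => memLp_two_exp_iff.2 ?_
    exact (integrableOn_Ici_iff_integrableOn_Ioi (by simp)).2
      (integrableOn_exp_mul_Ioi (by linarith) 0)

section ExpFlow

variable {ι E : Type*} [Fintype ι] [NormedAddCommGroup E] [InnerProductSpace ℝ E]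
  {S : E →L[ℝ] E} {b : OrthonormalBasis ι ℝ E} {w : ι → ℝ} {x : E}

/-- The solution of `x' = -S x` with initial value `x`, for the operator `S` that is diagonal in the
orthonormal basis `b` with the eigenvalues `w`. -/
def expFlow (b : OrthonormalBasis ι ℝ E) (w : ι → ℝ) (x : E) (t : ℝ) : E :=
  ∑ k, Real.exp (-(w k * t)) • inner ℝ (b k) x • b k

theorem expFlow_apply_zero (b : OrthonormalBasis ι ℝ E) (w : ι → ℝ) (x : E) :
    expFlow b w x 0 = x := by
  simp [expFlow, b.sum_repr']

theorem expFlow_zero (b : OrthonormalBasis ι ℝ E) (w : ι → ℝ) : expFlow b w 0 = 0 := by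
  ext1 t
  simp [expFlow]

theorem inner_expFlow (k : ι) (t : ℝ) :
    inner ℝ (b k) (expFlow b w x t) = Real.exp (-(w k * t)) * inner ℝ (b k) x := by
  simp only [expFlow, smul_smul]
  exact b.orthonormal.inner_right_fintype _ k

theorem isPrimitive_expFlow [CompleteSpace E] (h : IsDiagonal S b w) (x : E) :
    IsPrimitive (expFlow b w x) (fun t => -S (expFlow b w x t)) := by
  have hterm (k : ι) := (isPrimitive_exp_mul (-w k)).clm_comp
    (ContinuousLinearMap.toSpanSingleton ℝ (inner ℝ (b k) x • b k))
  convert IsPrimitive.sum Finset.univ hterm using 2 with t t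
  · simp [expFlow]
  · simp only [expFlow, map_sum, map_smul, h _, ← Finset.sum_neg_distrib, neg_mul,
      ContinuousLinearMap.toSpanSingleton_apply]
    refine Finset.sum_congr rfl fun k _ => ?_
    module

theorem eq_expFlow_of_ae [CompleteSpace E] (h : IsDiagonal S b w) {F f : ℝ → E}
    (hF : IsPrimitive F f) {t : ℝ} (hf : ∀ᵐ s, s ∈ Set.uIoc 0 t → f s = -S (F s)) :
    F t = expFlow b w (F 0) t := by
  refine eq_of_forall_inner_eq (b := b) fun k => ?_
  rw [inner_expFlow]
  refine (hF.clm_comp (innerSL ℝ (b k))).eq_exp ?_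
  filter_upwards [hf] with s hs hs'
  simp only [hs hs', map_neg, innerSL_apply_apply, h.inner_apply]

theorem memLp_expFlow_iff {μ : Measure ℝ} :
    MemLp (expFlow b w x) 2 μ ↔
      ∀ k, inner ℝ (b k) x = 0 ∨ MemLp (fun t => Real.exp (-(w k * t))) 2 μ := by
  constructor
  · refine fun h k => or_iff_not_imp_left.2 fun hk => ?_
    have hcoord : MemLp (fun t => Real.exp (-(w k * t)) * inner ℝ (b k) x) 2 μ := by
      simpa only [inner_expFlow] using h.const_inner (𝕜 := ℝ) (b k)
    simpa only [mul_inv_cancel_right₀ hk] using hcoord.mul_const (inner ℝ (b k) x)⁻¹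
  · refine fun h => memLp_finsetSum _ fun k _ => ?_
    rcases h k with hk | hk
    · simp [hk]
    · exact (ContinuousLinearMap.toSpanSingleton ℝ (inner ℝ (b k) x • b k)).comp_memLp' hk

theorem memLp_expFlow_Iio_iff :
    MemLp (expFlow b w x) 2 (volume.restrict (Set.Iio 0)) ↔ x ∈ negSpace b w := by
  rw [memLp_expFlow_iff, mem_negSpace]
  exact forall_congr' fun k => by rw [memLp_two_exp_Iio_iff, ← not_lt, or_comm, or_iff_not_imp_left]

theorem memLp_expFlow_Ici_iff (hw : ∀ k, w k ≠ 0) :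
    MemLp (expFlow b w x) 2 (volume.restrict (Set.Ici 0)) ↔ x ∈ (negSpace b w)ᗮ := by
  rw [memLp_expFlow_iff, mem_orthogonal_negSpace]
  exact forall_congr' fun k => by
    rw [memLp_two_exp_Ici_iff, or_comm, or_iff_not_imp_left, not_lt, (hw k).le_iff_lt]

end ExpFlow

/-! ### The model operator -/

section StepCoeff

variable {E : Type*} [NormedAddCommGroup E] [NormedSpace ℝ E]

/-- The coefficient that jumps from `Sm` to `Sp` at the origin. -/
def stepCoeff (Sm Sp : E →L[ℝ] E) : Lp (E →L[ℝ] E) ∞ (volume : Measure ℝ) :=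
  (MemLp.piecewise measurableSet_Iio (memLp_top_const Sm) (memLp_top_const Sp)).toLp
    ((Set.Iio 0).piecewise (fun _ => Sm) fun _ => Sp)

theorem stepCoeff_ae_eq (Sm Sp : E →L[ℝ] E) :
    stepCoeff Sm Sp =ᵐ[volume] (Set.Iio 0).piecewise (fun _ => Sm) fun _ => Sp :=
  MemLp.coeFn_toLp _

theorem neg_stepCoeff (Sm Sp : E →L[ℝ] E) : -stepCoeff Sm Sp = stepCoeff (-Sm) (-Sp) := by
  rw [stepCoeff, stepCoeff, ← MemLp.toLp_neg, MemLp.toLp_eq_toLp_iff]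
  refine ae_of_all _ fun t => ?_
  by_cases ht : t ∈ Set.Iio 0 <;> simp [Set.piecewise, ht]

theorem isSymmetric_stepCoeff {E : Type*} [NormedAddCommGroup E] [InnerProductSpace ℝ E]
    {Sm Sp : E →L[ℝ] E} (hSm : Sm.IsSymmetric) (hSp : Sp.IsSymmetric) :
    ∀ᵐ t, (stepCoeff Sm Sp t).IsSymmetric := by
  filter_upwards [stepCoeff_ae_eq Sm Sp] with t ht
  rw [ht, Set.piecewise]
  split_ifs
  exacts [hSm, hSp]

end StepCoeff

section JumpOp

variable {n : ℕ} {Sm Sp : EuclideanSpace ℝ (Fin n) →L[ℝ] EuclideanSpace ℝ (Fin n)}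
  {bm bp : OrthonormalBasis (Fin n) ℝ (EuclideanSpace ℝ (Fin n))} {wm wp : Fin n → ℝ}

/-- The model operator `∂ₜ + A(t)` for the path `A` that jumps from `Sm` to `Sp` at the origin. -/
def jumpOp (Sm Sp : EuclideanSpace ℝ (Fin n) →L[ℝ] EuclideanSpace ℝ (Fin n)) :
    W12 n →L[ℝ] L2 n :=
  lineOp (multOp (stepCoeff Sm Sp))

theorem jumpOp_ae_eq (Sm Sp : EuclideanSpace ℝ (Fin n) →L[ℝ] EuclideanSpace ℝ (Fin n))
    (p : W12 n) :
    jumpOp Sm Sp p =ᵐ[volume] (Set.Iio 0).piecewise (fun t => W12.dt n p t + Sm (W12.rep p t))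
      fun t => W12.dt n p t + Sp (W12.rep p t) := by
  filter_upwards [Lp.coeFn_add (W12.dt n p) (multOp (stepCoeff Sm Sp) (W12.incl n p)),
    multOp_ae_eq (stepCoeff Sm Sp) (W12.incl n p), stepCoeff_ae_eq Sm Sp,
    W12.incl_ae_eq_rep p] with t hadd hmult hstep hrep
  rw [jumpOp, lineOp_apply, hadd, Pi.add_apply, hmult, hstep, hrep]
  by_cases ht : t ∈ Set.Iio 0 <;> simp [Set.piecewise, ht]

theorem lineOp_compLpL_ae_eq (S : EuclideanSpace ℝ (Fin n) →L[ℝ] EuclideanSpace ℝ (Fin n))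
    (p : W12 n) :
    lineOp (S.compLpL 2 volume) p =ᵐ[volume] fun t => W12.dt n p t + S (W12.rep p t) := by
  filter_upwards [Lp.coeFn_add (W12.dt n p) (S.compLpL 2 volume (W12.incl n p)),
    S.coeFn_compLpL (W12.incl n p), W12.incl_ae_eq_rep p] with t hadd hcomp hrep
  rw [lineOp_apply, hadd, Pi.add_apply, hcomp, hrep]

theorem mem_ker_jumpOp_iff {p : W12 n} :
    p ∈ (jumpOp Sm Sp).ker ↔ W12.dt n p =ᵐ[volume]
      (Set.Iio 0).piecewise (fun t => -Sm (W12.rep p t)) fun t => -Sp (W12.rep p t) := by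
  rw [LinearMap.mem_ker, ContinuousLinearMap.coe_coe, Lp.eq_zero_iff_ae_eq_zero]
  refine eventually_congr ?_
  filter_upwards [jumpOp_ae_eq Sm Sp p] with t ht
  rw [ht]
  by_cases ht : t ∈ Set.Iio 0 <;> simp [Set.piecewise, ht, add_eq_zero_iff_eq_neg]

theorem rep_eq_of_mem_ker_jumpOp (hm : IsDiagonal Sm bm wm) (hp : IsDiagonal Sp bp wp) {p : W12 n}
    (h : p ∈ (jumpOp Sm Sp).ker) :
    W12.rep p = (Set.Iio 0).piecewise (expFlow bm wm (W12.rep p 0))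
      (expFlow bp wp (W12.rep p 0)) := by
  have hdt := mem_ker_jumpOp_iff.1 h
  ext1 t
  rcases lt_or_ge t 0 with ht | ht
  · rw [Set.piecewise_eq_of_mem (Set.Iio 0) _ _ ht]
    refine eq_expFlow_of_ae hm (W12.isPrimitive_rep p) ?_
    filter_upwards [hdt, compl_mem_ae_iff.2 (measure_singleton 0)] with s hs hs0 hst
    rw [Set.uIoc_of_ge ht.le] at hst
    exact hs.trans (Set.piecewise_eq_of_mem (Set.Iio 0) _ _ (hst.2.lt_of_ne hs0))
  · rw [Set.piecewise_eq_of_notMem (Set.Iio 0) _ _ ht.not_gt]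
    refine eq_expFlow_of_ae hp (W12.isPrimitive_rep p) ?_
    filter_upwards [hdt] with s hs hst
    rw [Set.uIoc_of_le ht] at hst
    exact hs.trans (Set.piecewise_eq_of_notMem (Set.Iio 0) _ _ hst.1.le.not_gt)

theorem rep_zero_mem_of_mem_ker_jumpOp (hm : IsDiagonal Sm bm wm) (hp : IsDiagonal Sp bp wp)
    (hwp : ∀ k, wp k ≠ 0) {p : W12 n} (h : p ∈ (jumpOp Sm Sp).ker) :
    W12.rep p 0 ∈ negSpace bm wm ⊓ (negSpace bp wp)ᗮ := by
  have hrep := rep_eq_of_mem_ker_jumpOp hm hp h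
  constructor
  · rw [SetLike.mem_coe, ← memLp_expFlow_Iio_iff]
    refine ((W12.memLp_rep p).restrict (Set.Iio 0)).ae_eq ?_
    filter_upwards [ae_restrict_mem measurableSet_Iio] with t ht
    exact (congrFun hrep t).trans (Set.piecewise_eq_of_mem _ _ _ ht)
  · rw [SetLike.mem_coe, ← memLp_expFlow_Ici_iff hwp]
    refine ((W12.memLp_rep p).restrict (Set.Ici 0)).ae_eq ?_
    filter_upwards [ae_restrict_mem measurableSet_Ici] with t ht
    exact (congrFun hrep t).trans
      (Set.piecewise_eq_of_notMem (Set.Iio 0) _ _ (Set.mem_Ici.1 ht).not_gt)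

theorem exists_mem_ker_jumpOp (hm : IsDiagonal Sm bm wm) (hp : IsDiagonal Sp bp wp)
    (hwp : ∀ k, wp k ≠ 0) {x : EuclideanSpace ℝ (Fin n)}
    (hx : x ∈ negSpace bm wm ⊓ (negSpace bp wp)ᗮ) :
    ∃ p ∈ (jumpOp Sm Sp).ker, W12.rep p 0 = x := by
  have hF := (isPrimitive_expFlow hm x).piecewise_Iio (isPrimitive_expFlow hp x)
    (by rw [expFlow_apply_zero, expFlow_apply_zero])
  have hLm := memLp_expFlow_Iio_iff.2 hx.1
  have hLp := (memLp_expFlow_Ici_iff hwp).2 hx.2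
  rw [← Set.compl_Iio] at hLp
  obtain ⟨p, hrep, hdt⟩ := W12.exists_rep_eq_and_dt_ae_eq hF
    (MemLp.piecewise measurableSet_Iio hLm hLp)
    (MemLp.piecewise measurableSet_Iio (Sm.comp_memLp' hLm).neg (Sp.comp_memLp' hLp).neg)
  refine ⟨p, mem_ker_jumpOp_iff.2 (hdt.trans (ae_of_all _ fun t => ?_)), ?_⟩
  · rw [hrep]
    by_cases ht : t ∈ Set.Iio 0 <;> simp only [Set.piecewise, ht, if_true, if_false]
  · rw [hrep, Set.piecewise_eq_of_notMem (Set.Iio 0) _ _ (lt_irrefl 0), expFlow_apply_zero]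

theorem map_evalAt_zero_ker_jumpOp (hm : IsDiagonal Sm bm wm) (hp : IsDiagonal Sp bp wp)
    (hwp : ∀ k, wp k ≠ 0) :
    (jumpOp Sm Sp).ker.map (W12.evalAt 0).toLinearMap = negSpace bm wm ⊓ (negSpace bp wp)ᗮ := by
  refine le_antisymm (Submodule.map_le_iff_le_comap.2 fun p h => ?_) fun x hx => ?_
  · exact rep_zero_mem_of_mem_ker_jumpOp hm hp hwp h
  · exact exists_mem_ker_jumpOp hm hp hwp hx

theorem injective_evalAt_zero_domRestrict_ker_jumpOp (hm : IsDiagonal Sm bm wm)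
    (hp : IsDiagonal Sp bp wp) :
    Function.Injective ((W12.evalAt 0).toLinearMap.domRestrict (jumpOp Sm Sp).ker) := by
  rw [← LinearMap.ker_eq_bot, LinearMap.ker_eq_bot']
  rintro ⟨p, h⟩ (h0 : W12.rep p 0 = 0)
  have hrep := rep_eq_of_mem_ker_jumpOp hm hp h
  rw [h0, expFlow_zero, expFlow_zero, Set.piecewise_same] at hrep
  have hincl : W12.incl n p = 0 := by
    rw [Lp.eq_zero_iff_ae_eq_zero, ← hrep]
    exact W12.incl_ae_eq_rep p
  exact Subtype.ext (W12.incl_injective (hincl.trans (map_zero _).symm))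

theorem finrank_ker_jumpOp (hm : IsDiagonal Sm bm wm) (hp : IsDiagonal Sp bp wp)
    (hwp : ∀ k, wp k ≠ 0) :
    Module.finrank ℝ (jumpOp Sm Sp).ker =
      Module.finrank ℝ (negSpace bm wm ⊓ (negSpace bp wp)ᗮ :
        Submodule ℝ (EuclideanSpace ℝ (Fin n))) := by
  rw [← map_evalAt_zero_ker_jumpOp hm hp hwp, ← LinearMap.range_domRestrict,
    LinearMap.finrank_range_of_inj (injective_evalAt_zero_domRestrict_ker_jumpOp hm hp)]

theorem mem_range_jumpOp_of_rep_zero_eq {p q : W12 n} (h0 : W12.rep p 0 = W12.rep q 0)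
    (h : lineOp (Sm.compLpL 2 volume) p = lineOp (Sp.compLpL 2 volume) q) :
    lineOp (Sm.compLpL 2 volume) p ∈ (jumpOp Sm Sp).range := by
  obtain ⟨r, hrep, hdt⟩ := W12.exists_rep_eq_and_dt_ae_eq
    ((W12.isPrimitive_rep p).piecewise_Iio (W12.isPrimitive_rep q) h0)
    (MemLp.piecewise measurableSet_Iio ((W12.memLp_rep p).restrict _)
      ((W12.memLp_rep q).restrict _))
    (MemLp.piecewise measurableSet_Iio ((Lp.memLp _).restrict _) ((Lp.memLp _).restrict _))
  refine ⟨r, Lp.ext ?_⟩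
  have hq := lineOp_compLpL_ae_eq Sp q
  rw [← h] at hq
  filter_upwards [jumpOp_ae_eq Sm Sp r, hdt, lineOp_compLpL_ae_eq Sm p, hq] with t hr hdt hp hq
  refine hr.trans ?_
  by_cases ht : t ∈ Set.Iio 0
  · simp only [Set.piecewise, ht, if_true, hdt, hrep, hp]
  · simp only [Set.piecewise, ht, if_false, hdt, hrep, hq]

/-- The right-hand sides whose solutions for the two constant coefficients agree at the origin form
the kernel of a linear map into a finite-dimensional space. -/
theorem finiteDimensional_coker_jumpOp (hSm : Sm.IsSymmetric) (hSm' : Function.Injective Sm)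
    (hSp : Sp.IsSymmetric) (hSp' : Function.Injective Sp) :
    FiniteDimensional ℝ (L2 n ⧸ (jumpOp Sm Sp).range) := by
  let em := LinearEquiv.ofBijective (lineOp (Sm.compLpL 2 volume)).toLinearMap
    (bijective_lineOp_compLpL hSm hSm')
  let ep := LinearEquiv.ofBijective (lineOp (Sp.compLpL 2 volume)).toLinearMap
    (bijective_lineOp_compLpL hSp hSp')
  let jump : L2 n →ₗ[ℝ] EuclideanSpace ℝ (Fin n) :=
    (W12.evalAt 0).toLinearMap ∘ₗ (em.symm.toLinearMap - ep.symm.toLinearMap)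
  refine Submodule.CoFG.of_le (S := jump.ker) (fun η hη => ?_) (Submodule.CoFG.ker jump)
  have hη_m : lineOp (Sm.compLpL 2 volume) (em.symm η) = η := em.apply_symm_apply η
  have hη_p : lineOp (Sp.compLpL 2 volume) (ep.symm η) = η := ep.apply_symm_apply η
  have h0 : W12.rep (em.symm η) 0 = W12.rep (ep.symm η) 0 :=
    sub_eq_zero.1 ((map_sub (W12.evalAt 0) (em.symm η) (ep.symm η)).symm.trans hη)
  rw [← hη_m]
  exact mem_range_jumpOp_of_rep_zero_eq h0 (hη_m.trans hη_p.symm)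

theorem isFredholm_jumpOp (hm : IsDiagonal Sm bm wm) (hp : IsDiagonal Sp bp wp)
    (hwm : ∀ k, wm k ≠ 0) (hwp : ∀ k, wp k ≠ 0) : (jumpOp Sm Sp).IsFredholm := by
  have := FiniteDimensional.of_injective _ (injective_evalAt_zero_domRestrict_ker_jumpOp hm hp)
  have := finiteDimensional_coker_jumpOp hm.isSymmetric (hm.injective hwm) hp.isSymmetric
    (hp.injective hwp)
  exact isFredholm_of_finiteDimensional _

theorem finrank_coker_jumpOp (hm : IsDiagonal Sm bm wm) (hp : IsDiagonal Sp bp wp)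
    (hwm : ∀ k, wm k ≠ 0) (hwp : ∀ k, wp k ≠ 0) :
    Module.finrank ℝ (L2 n ⧸ (jumpOp Sm Sp).range) =
      Module.finrank ℝ ((negSpace bm wm)ᗮ ⊓ negSpace bp wp :
        Submodule ℝ (EuclideanSpace ℝ (Fin n))) := by
  have hadjoint : lineOp (-multOp (stepCoeff Sm Sp)) = jumpOp (-Sm) (-Sp) := by
    rw [jumpOp, ← neg_stepCoeff, map_neg]
  have hwp_neg : ∀ k, (-wp) k ≠ 0 := fun k => neg_ne_zero.2 (hwp k)
  rw [jumpOp, finrank_coker_lineOp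
      (isSymmetric_multOp (isSymmetric_stepCoeff hm.isSymmetric hp.isSymmetric))
      (isFredholm_jumpOp hm hp hwm hwp).isClosed_range,
    hadjoint, finrank_ker_jumpOp hm.neg hp.neg hwp_neg, negSpace_neg hwm, negSpace_neg hwp,
    Submodule.orthogonal_orthogonal]

theorem fredholmIndex_jumpOp (hm : IsDiagonal Sm bm wm) (hp : IsDiagonal Sp bp wp)
    (hwm : ∀ k, wm k ≠ 0) (hwp : ∀ k, wp k ≠ 0) :
    fredholmIndex (jumpOp Sm Sp) =
      Module.finrank ℝ (negSpace bm wm) - Module.finrank ℝ (negSpace bp wp) := by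
  rw [fredholmIndex, finrank_ker_jumpOp hm hp hwp, finrank_coker_jumpOp hm hp hwm hwp,
    finrank_inf_orthogonal_sub_finrank_orthogonal_inf]

end JumpOp

/-! ### Coefficients vanishing at infinity -/

section IndicatorConst

variable {α E : Type*} [MeasurableSpace α] {μ : Measure α} [NormedAddCommGroup E]
  [NormedSpace ℝ E] {s : Set α}

/-- `indicatorConstLp` as a continuous linear map of the constant. -/
def indicatorConstCLM (p : ℝ≥0∞) [Fact (1 ≤ p)] (hs : MeasurableSet s) (hμs : μ s ≠ ⊤) :
    E →L[ℝ] Lp E p μ :=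
  LinearMap.mkContinuous
    { toFun := indicatorConstLp p hs hμs
      map_add' := fun _ _ => indicatorConstLp_add.symm
      map_smul' := fun r c => by
        rw [RingHom.id_apply, indicatorConstLp, indicatorConstLp, ← MemLp.toLp_const_smul,
          MemLp.toLp_eq_toLp_iff]
        exact .of_eq (Set.indicator_const_smul s r fun _ => c) }
    (μ.real s ^ (1 / p.toReal)) fun c =>
    (norm_indicatorConstLp_le (hs := hs) (hμs := hμs)).trans_eq (mul_comm _ _)

theorem indicatorConstCLM_ae_eq (p : ℝ≥0∞) [Fact (1 ≤ p)] (hs : MeasurableSet s)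
    (hμs : μ s ≠ ⊤) (c : E) : indicatorConstCLM p hs hμs c =ᵐ[μ] s.indicator fun _ => c :=
  indicatorConstLp_coeFn (hs := hs) (hμs := hμs)

end IndicatorConst

section Cutoff

variable {n : ℕ}

/-- Multiplication by the indicator function of `[-R, R)`. -/
def cutoff (R : ℕ) : L2 n →L[ℝ] L2 n :=
  multOp (((memLp_top_const (ContinuousLinearMap.id ℝ (EuclideanSpace ℝ (Fin n)))).indicator
    (measurableSet_Ico (a := -(R : ℝ)) (b := R))).toLp (μ := volume) _)

theorem cutoff_ae_eq (R : ℕ) (f : L2 n) :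
    cutoff R f =ᵐ[volume] (Set.Ico (-(R : ℝ)) R).indicator f := by
  have hid := memLp_top_const (μ := (volume : Measure ℝ))
    (ContinuousLinearMap.id ℝ (EuclideanSpace ℝ (Fin n)))
  filter_upwards [multOp_ae_eq _ f,
    (hid.indicator (measurableSet_Ico (a := -(R : ℝ)) (b := R))).coeFn_toLp] with t hmult hid
  rw [cutoff, hmult, hid]
  by_cases ht : t ∈ Set.Ico (-(R : ℝ)) R
  · rw [Set.indicator_of_mem ht, Set.indicator_of_mem ht, ContinuousLinearMap.id_apply]
  · rw [Set.indicator_of_notMem ht, Set.indicator_of_notMem ht, zero_apply]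

/-- Step-function interpolation of a Sobolev function on `[-R, R)`, on the grid with `N` points per
unit of length. -/
def gridSample (R N : ℕ) : W12 n →L[ℝ] L2 n :=
  ∑ k ∈ Finset.Ico (-(R * N : ℤ)) (R * N),
    indicatorConstCLM 2 (measurableSet_Ico (a := (k / N : ℝ)) (b := (k + 1) / N))
      measure_Ico_lt_top.ne ∘L W12.evalAt (k / N)

theorem hasFiniteRange_gridSample (R N : ℕ) :
    (gridSample R N : W12 n →L[ℝ] L2 n).toLinearMap.HasFiniteRange := by
  refine Finset.sum_induction _ (fun F : W12 n →L[ℝ] L2 n => F.toLinearMap.HasFiniteRange)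
    (fun _ _ => LinearMap.HasFiniteRange.add) LinearMap.HasFiniteRange.zero fun k _ => ?_
  exact LinearMap.HasFiniteRange.comp_left LinearMap.HasFiniteRange.of_isNoetherian_rng _

theorem mem_Ico_div_iff_floor_eq {N : ℕ} (hN : 0 < N) (t : ℝ) (k : ℤ) :
    t ∈ Set.Ico (k / N : ℝ) ((k + 1) / N) ↔ ⌊t * N⌋ = k := by
  have hN' : (0 : ℝ) < N := Nat.cast_pos.2 hN
  rw [Int.floor_eq_iff, Set.mem_Ico, div_le_iff₀ hN', lt_div_iff₀ hN']

theorem floor_mul_mem_Ico_iff {N : ℕ} (hN : 0 < N) (R : ℕ) (t : ℝ) :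
    ⌊t * N⌋ ∈ Finset.Ico (-(R * N : ℤ)) (R * N) ↔ t ∈ Set.Ico (-(R : ℝ)) R := by
  have hN' : (0 : ℝ) < N := Nat.cast_pos.2 hN
  rw [Finset.mem_Ico, Int.le_floor, Int.floor_lt, Set.mem_Ico]
  push_cast
  rw [← neg_mul, mul_le_mul_iff_left₀ hN', mul_lt_mul_iff_left₀ hN']

theorem gridSample_ae_eq {N : ℕ} (hN : 0 < N) (R : ℕ) (p : W12 n) :
    gridSample R N p =ᵐ[volume]
      (Set.Ico (-(R : ℝ)) R).indicator fun t => W12.rep p (⌊t * N⌋ / N) := by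
  have hstep : ∀ᵐ t : ℝ, ∀ k : ℤ,
      indicatorConstCLM 2 (measurableSet_Ico (a := (k / N : ℝ)) (b := (k + 1) / N))
        measure_Ico_lt_top.ne (W12.rep p (k / N)) t =
      (Set.Ico (k / N : ℝ) ((k + 1) / N)).indicator (fun _ => W12.rep p (k / N)) t :=
    ae_all_iff.2 fun k => indicatorConstCLM_ae_eq 2 measurableSet_Ico measure_Ico_lt_top.ne _
  have hsum := Lp.coeFn_finsetSum (Finset.Ico (-(R * N : ℤ)) (R * N)) fun k =>
    indicatorConstCLM 2 (measurableSet_Ico (a := (k / N : ℝ)) (b := (k + 1) / N))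
      (measure_Ico_lt_top (μ := volume)).ne (W12.rep p (k / N))
  rw [gridSample, sum_apply]
  filter_upwards [hstep, hsum] with t hstep hsum
  refine hsum.trans ?_
  simp only [Finset.sum_apply, hstep]
  by_cases ht : t ∈ Set.Ico (-(R : ℝ)) R
  · rw [Set.indicator_of_mem ht,
      Finset.sum_eq_single_of_mem _ ((floor_mul_mem_Ico_iff hN R t).2 ht) fun k _ hk =>
        Set.indicator_of_notMem (fun h => hk ((mem_Ico_div_iff_floor_eq hN t k).1 h).symm) _,
      Set.indicator_of_mem ((mem_Ico_div_iff_floor_eq hN t _).2 rfl)]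
  · rw [Set.indicator_of_notMem ht]
    refine Finset.sum_eq_zero fun k hk => Set.indicator_of_notMem (fun h => ht ?_) _
    rwa [← floor_mul_mem_Ico_iff hN, (mem_Ico_div_iff_floor_eq hN t k).1 h]

theorem norm_rep_sub_rep_floor_le {N : ℕ} (hN : 0 < N) (p : W12 n) (t : ℝ) :
    ‖W12.rep p t - W12.rep p (⌊t * N⌋ / N)‖ ≤ √(1 / N) * ‖p‖ := by
  obtain ⟨hle, hlt⟩ := (mem_Ico_div_iff_floor_eq hN t _).2 rfl
  refine (W12.norm_rep_sub_rep_le p hle).trans ?_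
  gcongr
  rw [sub_le_iff_le_add', ← add_div]
  exact hlt.le

theorem norm_cutoff_comp_incl_sub_gridSample_le {N : ℕ} (hN : 0 < N) (R : ℕ) :
    ‖cutoff R ∘L W12.incl n - gridSample R N‖ ≤ √(1 / N) * √(2 * R) := by
  refine ContinuousLinearMap.opNorm_le_bound _ (by positivity) fun p => ?_
  have hbound : ‖cutoff R (W12.incl n p) - gridSample R N p‖ ≤
      ‖indicatorConstLp 2 (measurableSet_Ico (a := -(R : ℝ)) (b := R))
        (measure_Ico_lt_top (μ := volume)).ne (√(1 / N) * ‖p‖)‖ := by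
    refine Lp.norm_le_norm_of_ae_le ?_
    filter_upwards [Lp.coeFn_sub (cutoff R (W12.incl n p)) (gridSample R N p),
      cutoff_ae_eq R (W12.incl n p), gridSample_ae_eq hN R p, W12.incl_ae_eq_rep p,
      indicatorConstLp_coeFn (p := 2) (hs := measurableSet_Ico (a := -(R : ℝ)) (b := R))
        (μ := volume) (hμs := measure_Ico_lt_top.ne) (c := √(1 / (N : ℝ)) * ‖p‖)]
      with t hsub hcut hgrid hrep hconst
    rw [hsub, Pi.sub_apply, hcut, hgrid, hconst]
    by_cases ht : t ∈ Set.Ico (-(R : ℝ)) R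
    · simp only [Set.indicator_of_mem ht, hrep]
      exact (norm_rep_sub_rep_floor_le hN p t).trans (le_abs_self _)
    · simp only [Set.indicator_of_notMem ht, sub_zero, norm_zero, le_refl]
  refine hbound.trans_eq ?_
  rw [norm_indicatorConstLp two_ne_zero ENNReal.ofNat_ne_top, Real.volume_real_Ico,
    sub_neg_eq_add, ← two_mul, max_eq_left (by positivity), ENNReal.toReal_ofNat,
    ← Real.sqrt_eq_rpow, Real.norm_of_nonneg (by positivity), mul_right_comm]

theorem cutoff_comp_incl_mem_closure_hasFiniteRange (R : ℕ) :
    cutoff R ∘L W12.incl n ∈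
      closure {F : W12 n →L[ℝ] L2 n | F.toLinearMap.HasFiniteRange} := by
  have hbound : Tendsto (fun N : ℕ => √(1 / (N : ℝ)) * √(2 * R)) atTop (𝓝 0) := by
    simpa only [Real.sqrt_zero, zero_mul] using
      tendsto_one_div_atTop_nhds_zero_nat.sqrt.mul_const √(2 * (R : ℝ))
  refine (SeminormedAddCommGroup.mem_closure_iff (E := W12 n →L[ℝ] L2 n)).2 fun ε hε => ?_
  obtain ⟨N, hNε, hN⟩ := ((hbound.eventually_lt_const hε).and (eventually_gt_atTop 0)).exists
  exact ⟨gridSample R N, hasFiniteRange_gridSample R N,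
    (norm_cutoff_comp_incl_sub_gridSample_le hN R).trans_lt hNε⟩

variable {B : Lp (EuclideanSpace ℝ (Fin n) →L[ℝ] EuclideanSpace ℝ (Fin n)) ∞
  (volume : Measure ℝ)}

theorem norm_multOp_comp_cutoff_sub_le {R : ℕ} {ε : ℝ} (hε : 0 ≤ ε)
    (hB : ∀ᵐ t, t ∉ Set.Ico (-(R : ℝ)) R → ‖B t‖ ≤ ε) :
    ‖multOp B ∘L cutoff R - multOp B‖ ≤ ε := by
  refine ContinuousLinearMap.opNorm_le_bound _ hε fun f => ?_
  rw [sub_apply, ContinuousLinearMap.comp_apply, ← map_sub]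
  refine Lp.norm_le_mul_norm_of_ae_le_mul ?_
  filter_upwards [hB, multOp_ae_eq B (cutoff R f - f), Lp.coeFn_sub (cutoff R f) f,
    cutoff_ae_eq R f] with t hB hmult hsub hcut
  rw [hmult, hsub, Pi.sub_apply, hcut]
  by_cases ht : t ∈ Set.Ico (-(R : ℝ)) R
  · rw [Set.indicator_of_mem ht, sub_self, map_zero, norm_zero]
    positivity
  · rw [Set.indicator_of_notMem ht, zero_sub, map_neg, norm_neg]
    exact (B t).le_of_opNorm_le (hB ht) _

theorem tendsto_multOp_comp_cutoff (hB : Tendsto B (ae volume ⊓ Bornology.cobounded ℝ) (𝓝 0)) :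
    Tendsto (fun R => multOp B ∘L cutoff R) atTop (𝓝 (multOp B)) := by
  rw [Metric.tendsto_atTop']
  intro ε hε
  have hsmall : ∀ᶠ t in ae volume ⊓ Bornology.cobounded ℝ, ‖B t‖ ≤ ε / 2 :=
    (tendsto_zero_iff_norm_tendsto_zero.1 hB).eventually_le_const (half_pos hε)
  obtain ⟨s, hs, u, hu, hsu⟩ := mem_inf_iff_superset.1 hsmall
  obtain ⟨r, -, hr⟩ := hasBasis_cobounded_norm.mem_iff.1 hu
  obtain ⟨R₀, hR₀⟩ := exists_nat_ge r
  refine ⟨R₀, fun R hR => ?_⟩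
  rw [dist_eq_norm]
  refine (norm_multOp_comp_cutoff_sub_le (half_pos hε).le ?_).trans_lt (half_lt_self hε)
  filter_upwards [hs] with t hts ht
  have hRt : (R : ℝ) ≤ ‖t‖ := by
    contrapose! ht
    exact ⟨(abs_lt.1 ht).1.le, (abs_lt.1 ht).2⟩
  exact hsu ⟨hts, hr ((hR₀.trans (Nat.cast_le.2 hR.le)).trans hRt)⟩

theorem multOp_comp_incl_mem_closure_hasFiniteRange
    (hB : Tendsto B (ae volume ⊓ Bornology.cobounded ℝ) (𝓝 0)) :
    multOp B ∘L W12.incl n ∈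
      closure {F : W12 n →L[ℝ] L2 n | F.toLinearMap.HasFiniteRange} := by
  have hlim : Tendsto (fun R => (multOp B ∘L cutoff R) ∘L W12.incl n) atTop
      (𝓝 (multOp B ∘L W12.incl n)) :=
    ((continuous_id.clm_comp continuous_const).tendsto _).comp (tendsto_multOp_comp_cutoff hB)
  refine isClosed_closure.mem_of_tendsto hlim (Eventually.of_forall fun R => ?_)
  exact comp_mem_closure_hasFiniteRange (multOp B)
    (cutoff_comp_incl_mem_closure_hasFiniteRange R)

end Cutoff

section StepCoeffLimits

variable {E : Type*} [NormedAddCommGroup E] [NormedSpace ℝ E]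

theorem tendsto_stepCoeff_atBot (Sm Sp : E →L[ℝ] E) :
    Tendsto (stepCoeff Sm Sp) (ae volume ⊓ atBot) (𝓝 Sm) := by
  refine tendsto_const_nhds.congr' ?_
  filter_upwards [(stepCoeff_ae_eq Sm Sp).filter_mono inf_le_left,
    (eventually_lt_atBot 0).filter_mono inf_le_right] with t hstep ht
  rw [hstep, Set.piecewise_eq_of_mem (Set.Iio 0) _ _ ht]

theorem tendsto_stepCoeff_atTop (Sm Sp : E →L[ℝ] E) :
    Tendsto (stepCoeff Sm Sp) (ae volume ⊓ atTop) (𝓝 Sp) := by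
  refine tendsto_const_nhds.congr' ?_
  filter_upwards [(stepCoeff_ae_eq Sm Sp).filter_mono inf_le_left,
    (eventually_ge_atTop 0).filter_mono inf_le_right] with t hstep ht
  rw [hstep, Set.piecewise_eq_of_notMem (Set.Iio 0) _ _ ht.not_gt]

theorem tendsto_sub_stepCoeff {B : Lp (E →L[ℝ] E) ∞ (volume : Measure ℝ)} {Sm Sp : E →L[ℝ] E}
    (hm : Tendsto B (ae volume ⊓ atBot) (𝓝 Sm)) (hp : Tendsto B (ae volume ⊓ atTop) (𝓝 Sp)) :
    Tendsto (B - stepCoeff Sm Sp : Lp (E →L[ℝ] E) ∞ (volume : Measure ℝ))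
      (ae volume ⊓ Bornology.cobounded ℝ) (𝓝 0) := by
  refine Tendsto.congr' ((Lp.coeFn_sub B (stepCoeff Sm Sp)).symm.filter_mono inf_le_left) ?_
  rw [IsOrderBornology.cobounded_eq, inf_sup_left, tendsto_sup]
  constructor
  · simpa only [sub_self, Pi.sub_def] using hm.sub (tendsto_stepCoeff_atBot Sm Sp)
  · simpa only [sub_self, Pi.sub_def] using hp.sub (tendsto_stepCoeff_atTop Sm Sp)

end StepCoeffLimits

/-! ### Continuous coefficients -/

section ActCoeff

variable {n : ℕ} {A : ℝ → Matrix (Fin n) (Fin n) ℝ}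

theorem memLp_top_act (hA : Continuous A) (hb : ∃ C, ∀ t, ‖act (A t)‖ ≤ C) :
    MemLp (fun t => act (A t)) ∞ (volume : Measure ℝ) :=
  hb.elim fun C hC => memLp_top_of_bound (continuous_act.comp hA).aestronglyMeasurable C
    (ae_of_all _ hC)

/-- A bounded continuous path of matrices as an `L^∞` coefficient. -/
def actCoeff (A : ℝ → Matrix (Fin n) (Fin n) ℝ) (hA : Continuous A)
    (hb : ∃ C, ∀ t, ‖act (A t)‖ ≤ C) :
    Lp (EuclideanSpace ℝ (Fin n) →L[ℝ] EuclideanSpace ℝ (Fin n)) ∞ (volume : Measure ℝ) :=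
  (memLp_top_act hA hb).toLp

theorem opF_eq_lineOp_multOp (hA : Continuous A) (hb : ∃ C, ∀ t, ‖act (A t)‖ ≤ C) :
    opF A hA hb = lineOp (multOp (actCoeff A hA hb)) := by
  have hmul : mulOp A hA hb = multOp (actCoeff A hA hb) := by
    ext1 f
    refine Lp.ext ?_
    filter_upwards [(memLp_act hA hb f).coeFn_toLp, multOp_ae_eq (actCoeff A hA hb) f,
      (memLp_top_act hA hb).coeFn_toLp] with t hact hmult hcoeff
    exact hact.trans (by rw [hmult, actCoeff, hcoeff])
  rw [opF, lineOp, hmul]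

theorem tendsto_actCoeff (hA : Continuous A) (hb : ∃ C, ∀ t, ‖act (A t)‖ ≤ C) {l : Filter ℝ}
    {M : Matrix (Fin n) (Fin n) ℝ} (h : Tendsto A l (𝓝 M)) :
    Tendsto (actCoeff A hA hb) (ae volume ⊓ l) (𝓝 (act M)) :=
  (((continuous_act.tendsto M).comp h).mono_left inf_le_right).congr'
    ((memLp_top_act hA hb).coeFn_toLp.symm.filter_mono inf_le_left)

end ActCoeff

end FredholmLine

end

open FredholmLine in
theorem mainTheorem7_general {n : ℕ} {Am Ap : Matrix (Fin n) (Fin n) ℝ}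
    (hAm : Am.IsSymm) (hAp : Ap.IsSymm) (hAm' : IsUnit Am) (hAp' : IsUnit Ap)
    {B : Lp (EuclideanSpace ℝ (Fin n) →L[ℝ] EuclideanSpace ℝ (Fin n)) ∞ (volume : Measure ℝ)}
    (hm : Tendsto B (ae volume ⊓ atBot) (𝓝 (act Am)))
    (hp : Tendsto B (ae volume ⊓ atTop) (𝓝 (act Ap))) :
    ((lineOp (multOp B)).IsFredholm ∧
      fredholmIndex (lineOp (multOp B)) = (negInd Am : ℤ) - (negInd Ap : ℤ)) ∧
    ∀ {Z : Type*} [NormedAddCommGroup Z] [NormedSpace ℝ Z] [FiniteDimensional ℝ Z]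
      (K : Z →L[ℝ] L2 n),
      (K.coprod (lineOp (multOp B))).IsFredholm ∧
      fredholmIndex (K.coprod (lineOp (multOp B))) =
        (negInd Am : ℤ) - (negInd Ap : ℤ) + Module.finrank ℝ Z := by
  obtain ⟨bm, wm, hdm, hwm⟩ := exists_isDiagonal_act hAm hAm'
  obtain ⟨bp, wp, hdp, hwp⟩ := exists_isDiagonal_act hAp hAp'
  have hdecomp : lineOp (multOp B) = jumpOp (act Am) (act Ap) +
      (multOp (B - stepCoeff (act Am) (act Ap))).comp (W12.incl n) := by
    rw [jumpOp, ← lineOp_add, ← map_add, add_sub_cancel]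
  obtain ⟨hF, hindex⟩ := isFredholm_add_and_index_add_eq (isFredholm_jumpOp hdm hdp hwm hwp)
    (multOp_comp_incl_mem_closure_hasFiniteRange (tendsto_sub_stepCoeff hm hp))
  rw [← hdecomp] at hF hindex
  have hjump := fredholmIndex_jumpOp hdm hdp hwm hwp
  rw [finrank_negSpace, finrank_negSpace, ← hdm.negInd_eq_ncard, ← hdp.negInd_eq_ncard,
    fredholmIndex_eq_index, ← hindex] at hjump
  refine ⟨⟨hF, (fredholmIndex_eq_index _).trans hjump⟩, fun K => ?_⟩
  obtain ⟨hKF, hKindex⟩ := isFredholm_coprod_and_index_coprod hF K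
  exact ⟨hKF, by rw [fredholmIndex_eq_index, hKindex, hjump]⟩

open FredholmLine in
theorem mainTheorem7 (n : ℕ) (Am Ap : Matrix (Fin n) (Fin n) ℝ)
    (hAm : Am.IsSymm) (hAp : Ap.IsSymm) (hAm' : IsUnit Am) (hAp' : IsUnit Ap) :
    (∀ (A : ℝ → Matrix (Fin n) (Fin n) ℝ) (hA : Continuous A)
      (hm : Tendsto A atBot (𝓝 Am)) (hp : Tendsto A atTop (𝓝 Ap)),
      (opF A hA (exists_bound hA hm hp)).IsFredholm ∧
      fredholmIndex (opF A hA (exists_bound hA hm hp)) = (negInd Am : ℤ) - (negInd Ap : ℤ)) ∧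
    (∀ (l : ℕ) (A : (Fin l → unitInterval) → ℝ → Matrix (Fin n) (Fin n) ℝ)
      (hA : ∀ s, Continuous (A s))
      (hm : ∀ s, Tendsto (A s) atBot (𝓝 Am)) (hp : ∀ s, Tendsto (A s) atTop (𝓝 Ap))
      (s : Fin l → unitInterval) (K : EuclideanSpace ℝ (Fin l) →L[ℝ] L2 n),
      (opFParam l (A s) (hA s) (exists_bound (hA s) (hm s) (hp s)) K).IsFredholm ∧
      fredholmIndex (opFParam l (A s) (hA s) (exists_bound (hA s) (hm s) (hp s)) K) =
        (negInd Am : ℤ) - (negInd Ap : ℤ) + (l : ℤ)) := by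
  have general {A : ℝ → Matrix (Fin n) (Fin n) ℝ} (hA : Continuous A)
      (hm : Tendsto A atBot (𝓝 Am)) (hp : Tendsto A atTop (𝓝 Ap)) :=
    mainTheorem7_general hAm hAp hAm' hAp' (tendsto_actCoeff hA (exists_bound hA hm hp) hm)
      (tendsto_actCoeff hA (exists_bound hA hm hp) hp)
  simp only [← opF_eq_lineOp_multOp] at general
  exact ⟨fun A hA hm hp => (general hA hm hp).1, fun l A hA hm hp s K => by
    simpa only [opFParam, finrank_euclideanSpace_fin] using (general (hA s) (hm s) (hp s)).2 K⟩
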